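/- Let $p,q$ be odd primes with $p\equiv -1 \pmod q$. There is $\xi\in\mathbb Z_p$ such that $x^2+\xi x+1$ is irreducible over $\mathbb Z_p$ and its companion matrix $F=\begin{bmatrix}0&-1\\1&-\xi\end{bmatrix}$ has order $q$. For every such $\xi$, the group $\mathcal G_F=\mathbb Z_p^2\rtimes_F\mathbb Z_q$ (in which $1\in\mathbb Z_q$ acts on $\mathbb Z_p^2$ by $F$) is, up to isomorphism, the unique non-abelian group of order $p^2q$. A skew brace is a triple $(B,+,\circ)$ such that $(B,+)$ and $(B,\circ)$ are groups and $a\circ(b+c)=a\circ b-a+a\circ c$ for all $a,b,c\in B$; it is trivial if $a\circ b=a+b$ for all $a,b$; $\lambda:(B,\circ)\to\operatorname{Aut}(B,+)$ is the homomorphism $\lambda_a(b)=-a+a\circ b$. A skew brace is of $\mathcal G_F$-type if $(B,+)\cong\mathcal G_F$. Up to isomorphism there are exactly $p+2q-2$ skew braces of $\mathcal G_F$-type, namely the trivial one and $p+2q-3$ non-trivial ones. For each of them $|\ker\lambda|\in\{1,q,p^2,p^2q\}$, and up to isomorphism there are exactly: - $p+q-3$ with $|\ker\lambda|=1$, all with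 $(B,\circ)\cong\mathcal G_F$; - one with $|\ker\lambda|=q$, and it has $(B,\circ)\cong\mathbb Z_p^2\times\mathbb Z_q$; - $q-1$ with $|\ker\lambda|=p^2$, of which one has $(B,\circ)\cong\mathbb Z_p^2\times\mathbb Z_q$ and $q-2$ have $(B,\circ)\cong\mathcal G_F$; - one with $|\ker\lambda|=p^2q$, which is the trivial one. -/

import Mathlib

open Polynomial Matrix

universe u

/-! ### Skew braces -/

/-- A skew (left) brace: an additive group `(B, +)` (not necessarily commutative) and a group
`(B, ∘)`, written multiplicatively here, with `a ∘ (b + c) = a ∘ b - a + a ∘ c`. -/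
class SkewBrace (B : Type u) extends AddGroup B, Group B where
  mul_add_eq : ∀ a b c : B, a * (b + c) = a * b - a + a * c

namespace SkewBrace

section basic

variable {B : Type u} [SkewBrace B]

theorem mul_zero_eq (a : B) : a * 0 = a := by
  have h := mul_add_eq a 0 0
  rw [add_zero, sub_eq_add_neg, add_assoc] at h
  have h2 : -a + a * 0 = 0 := by
    have h3 : a * 0 + 0 = a * 0 + (-a + a * 0) := by rw [add_zero]; exact h
    exact (add_left_cancel h3).symm
  exact (neg_add_eq_zero.mp h2).symm

theorem one_eq_zero : (1 : B) = 0 := by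
  have h := mul_zero_eq (1 : B)
  rw [one_mul] at h
  exact h.symm

theorem mul_neg_add_eq (a b c : B) : a * (-b + c) = a - a * b + a * c := by
  have h := mul_add_eq a b (-b)
  rw [add_neg_cancel, mul_zero_eq] at h
  have h2 : a * (-b) = a - a * b + a := by
    have h3 : a * b - a + a * (-b) = a * b - a + (a - a * b + a) := by
      rw [← h]
      simp [sub_eq_add_neg, add_assoc]
    exact add_left_cancel h3
  rw [mul_add_eq, h2]
  simp [sub_eq_add_neg, add_assoc]

end basic

/-- The homomorphism `λ : (B, ∘) → Aut(B, +)`, `λ_a(b) = -a + a ∘ b`; the group `AddAut B`, whose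
operation is composition, is written additively in Mathlib. -/
def lam (B : Type u) [SkewBrace B] : B →* Multiplicative (AddAut B) where
  toFun a := Multiplicative.ofAdd
    { toFun := fun b => -a + a * b
      invFun := fun b => a⁻¹ * (a + b)
      left_inv := fun b => by simp
      right_inv := fun b => by simp
      map_add' := fun b c => by
        simp [mul_add_eq, sub_eq_add_neg, add_assoc] }
  map_one' := by
    apply Multiplicative.toAdd.injective
    ext b
    simp [one_eq_zero]
  map_mul' a b := by
    apply Multiplicative.toAdd.injective
    ext c
    simp [mul_neg_add_eq, sub_eq_add_neg, add_assoc, mul_assoc]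

theorem lam_apply {B : Type u} [SkewBrace B] (a b : B) :
    (lam B a).toAdd b = -a + a * b := rfl

/-- A skew brace is trivial if its two operations coincide. -/
def IsTrivial (B : Type u) [SkewBrace B] : Prop :=
  ∀ a b : B, a * b = a + b

end SkewBrace

/-- A skew brace bundled with its carrier. -/
structure BundledSkewBrace : Type (u + 1) where
  carrier : Type u
  [inst : SkewBrace carrier]

namespace BundledSkewBrace

instance : CoeSort BundledSkewBrace.{u} (Type u) := ⟨carrier⟩

instance (B : BundledSkewBrace.{u}) : SkewBrace B := B.inst

/-- Isomorphism of skew braces: a bijection that preserves both operations. -/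
instance isoSetoid : Setoid BundledSkewBrace.{u} where
  r A B := Nonempty (A ≃+* B)
  iseqv :=
    { refl := fun A => ⟨RingEquiv.refl A⟩
      symm := fun ⟨e⟩ => ⟨e.symm⟩
      trans := fun ⟨e⟩ ⟨f⟩ => ⟨e.trans f⟩ }

/-- The number of isomorphism classes of skew braces with the property `P`. -/
noncomputable def numIso (P : BundledSkewBrace.{u} → Prop) : ℕ∞ :=
  ((fun B => (Quotient.mk isoSetoid B)) '' {B | P B}).encard

/-- `B` is of `G`-type: its additive group is isomorphic to `G`. -/
def IsOfType (B : BundledSkewBrace.{u}) (G : Type) [Group G] : Prop :=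
  Nonempty (B ≃+ Additive G)

/-- The multiplicative group `(B, ∘)` is isomorphic to `G`. -/
def HasMulGroup (B : BundledSkewBrace.{u}) (G : Type) [Group G] : Prop :=
  Nonempty (B ≃* G)

/-- The order of the kernel of `λ : (B, ∘) → Aut(B, +)`. -/
noncomputable def cardKer (B : BundledSkewBrace.{u}) : ℕ :=
  Nat.card (SkewBrace.lam B).ker

end BundledSkewBrace

/-! ### The group `ℤ_p² ⋊_F ℤ_q` -/

/-- The matrix `F`, companion matrix of `x² + ξ x + 1`. -/
def companionF {p : ℕ} (ξ : ZMod p) : Matrix (Fin 2) (Fin 2) (ZMod p) :=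
  !![0, -1; 1, -ξ]

theorem companionF_pow_val {p q : ℕ} [NeZero q] {ξ : ZMod p} (hF : orderOf (companionF ξ) = q)
    (a b : ZMod q) :
    companionF ξ ^ (a + b).val = companionF ξ ^ a.val * companionF ξ ^ b.val := by
  have h := pow_mod_orderOf (companionF ξ) (a.val + b.val)
  rw [hF] at h
  rw [← pow_add, ZMod.val_add, h]

/-- The action of `ℤ_q` on `ℤ_p²` in which `1` acts by `F`, that is, `y` acts by `F ^ y`. -/
def actionF {p q : ℕ} [NeZero q] (ξ : ZMod p) (hF : orderOf (companionF ξ) = q) :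
    Multiplicative (ZMod q) →* MulAut (Multiplicative (Fin 2 → ZMod p)) where
  toFun y :=
    { toFun := fun v => .ofAdd ((companionF ξ ^ y.toAdd.val) *ᵥ v.toAdd)
      invFun := fun v => .ofAdd ((companionF ξ ^ (-y.toAdd).val) *ᵥ v.toAdd)
      left_inv := fun v => by
        apply Multiplicative.toAdd.injective
        rw [toAdd_ofAdd, toAdd_ofAdd, mulVec_mulVec, ← companionF_pow_val hF, neg_add_cancel,
          ZMod.val_zero, pow_zero, one_mulVec]
      right_inv := fun v => by
        apply Multiplicative.toAdd.injective
        rw [toAdd_ofAdd, toAdd_ofAdd, mulVec_mulVec, ← companionF_pow_val hF, add_neg_cancel,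
          ZMod.val_zero, pow_zero, one_mulVec]
      map_mul' := fun v w => by
        rw [toAdd_mul, mulVec_add, ofAdd_add] }
  map_one' := by
    ext1 v
    change Multiplicative.ofAdd ((companionF ξ ^ (0 : ZMod q).val) *ᵥ v.toAdd) = v
    rw [ZMod.val_zero, pow_zero, one_mulVec, ofAdd_toAdd]
  map_mul' a b := by
    ext1 v
    change Multiplicative.ofAdd ((companionF ξ ^ (a.toAdd + b.toAdd).val) *ᵥ v.toAdd) =
      Multiplicative.ofAdd ((companionF ξ ^ a.toAdd.val) *ᵥ (companionF ξ ^ b.toAdd.val) *ᵥ v.toAdd)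
    rw [mulVec_mulVec, companionF_pow_val hF]

/-- The group `𝒢_F = ℤ_p² ⋊_F ℤ_q`. -/
abbrev GroupF {p q : ℕ} [NeZero q] (ξ : ZMod p) (hF : orderOf (companionF ξ) = q) : Type :=
  Multiplicative (Fin 2 → ZMod p) ⋊[actionF ξ hF] Multiplicative (ZMod q)

/-- The abelian group `ℤ_p² × ℤ_q`, written multiplicatively. -/
abbrev GroupAb (p q : ℕ) : Type :=
  Multiplicative ((Fin 2 → ZMod p) × ZMod q)

/-!
Let `K` be a field with `p²` elements. As `q` divides `p + 1`, there is an embedding `w` of `ℤ_q`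
into the elements of norm one of `K`, and `1` and `w i` span `K` over the prime field for `i ≠ 0`
(`IsNormOneChar.exists_linComb`). The group `AffGroup w = K ⋊ ℤ_q`, in which `i` acts by `w i`, is
the model for the group in question. Every non-abelian group of order `p² q` is isomorphic to it
(`nonempty_affGroup_mulEquiv`): the Sylow `p`-subgroup is normal as `q < p`, it is elementary
abelian since otherwise it has no automorphism of order `q`, and for an automorphism `T` of order
`q` of the additive group of `K` some average `∑ i, w (-(k * i)) * T ^ i` with `k ≠ 0` is bijective
and intertwines `T` with the multiplication by `w k`.

In a skew brace whose additive group is `G = AffGroup w`, each `λ_x` is an automorphism of `G` of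
order dividing `p² q`. Such an automorphism is inner (`AffGroup.exists_conj_of_pow_eq_one`), because
additive maps of `K` that intertwine `w i` with `w i'` are linear or semilinear
(`IsNormOneChar.semilinear`). As `G` has no centre, `λ_x` is conjugation by `b x` for a homomorphism
`b : (B, ∘) → G`, and if `e x` is the element of `G` that belongs to `x`, then `a x = e x * b x` is
a homomorphism, too. So skew braces on `G` amount to pairs of homomorphisms `a, b` from a group to
`G` for which `a x * (b x)⁻¹` is a bijection, and isomorphism of skew braces amounts to equivalence
of pairs under `Aut G` (`SkewBrace.exists_isRealizedBy`,
`SkewBrace.IsRealizedBy.nonempty_ringEquiv`, `SkewBrace.IsRealizedBy.exists_mulEquiv`). The kernel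
of `λ` is that of `b`.

Up to translation such a pair has a normal form: an element of order `q` has images `(0, j + 1)` and
`(0, j)`, and the Sylow `p`-subgroup has as its image in `K × K` a subgroup that meets the diagonal
trivially and is stable under `(w (j + 1), w j)` (`SkewBrace.IsRealizedBy.exists_isNormalForm`). By
irreducibility this subgroup is `K × 0` or `0 × K`, or else `j = -1/2` and it is the graph `{(c x^p,
x)}` with `c` of norm other than `0` and `1` (`IsNormOneChar.trichotomy`). In the last case only the
norm of `c` matters, because scaling by `u` multiplies `c` by `u / u^p`, which is an arbitrary
element of norm one. This makes `q + q + (p - 2)` classes, and they are distinct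
(`BraceIndex.eq_of_iso`): `j` is determined by the maps to `ℤ_q`, the first family has a larger `ker
λ` than the others, and the square of the map `x ↦ c x^p` is the multiplication by the norm of `c`.
Reading off the kernels and the multiplicative groups gives the table.
-/

universe v

set_option linter.unusedSectionVars false

/-! ### The field of `p²` elements and its roots of unity of order `q` -/

/-- `w` is an embedding of `ℤ_q` into the multiplicative group of a field of `p²` elements, where
`p` and `q` are odd primes with `p ≡ -1` modulo `q`. -/
structure IsNormOneChar (p : ℕ) {q : ℕ} {K : Type u} [Field K] (w : AddChar (ZMod q) K) :
    Prop where
  card_eq : Nat.card K = p ^ 2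
  injective : Function.Injective w
  p_ne_two : p ≠ 2
  q_ne_two : q ≠ 2
  cast_eq : (p : ZMod q) = -1

namespace IsNormOneChar

variable {p q : ℕ} [Fact p.Prime] [Fact q.Prime] {K : Type u} [Field K]
  {w : AddChar (ZMod q) K}

theorem finite (hw : IsNormOneChar p w) : Finite K :=
  Nat.finite_of_card_ne_zero (by rw [hw.card_eq]; exact pow_ne_zero 2 (Fact.out : p.Prime).ne_zero)

theorem two_ne_zero (hw : IsNormOneChar p w) : (2 : ZMod q) ≠ 0 := by
  intro h
  have h1 : ((2 : ℕ) : ZMod q) = 0 := by exact_mod_cast h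
  rw [ZMod.natCast_eq_zero_iff] at h1
  exact hw.q_ne_two ((Nat.prime_dvd_prime_iff_eq Fact.out Nat.prime_two).mp h1)

theorem neg_ne_self (hw : IsNormOneChar p w) {i : ZMod q} (hi : i ≠ 0) : -i ≠ i := by
  intro h
  have h1 : 2 * i = 0 := by linear_combination -h
  exact (mul_ne_zero hw.two_ne_zero hi) h1

theorem lt (hw : IsNormOneChar p w) : q < p := by
  have hdvd : q ∣ p + 1 := by
    rw [← ZMod.natCast_eq_zero_iff, Nat.cast_add, hw.cast_eq]
    simp
  obtain ⟨c, hc⟩ := hdvd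
  obtain ⟨a, ha⟩ := (Fact.out : p.Prime).odd_of_ne_two hw.p_ne_two
  obtain ⟨b, hb⟩ := (Fact.out : q.Prime).odd_of_ne_two hw.q_ne_two
  have hp := (Fact.out : p.Prime).two_le
  -- `c` is even, since `p + 1` is even and `q` is odd
  have hc2 : 2 ≤ c := by
    by_contra! h
    interval_cases c <;> omega
  nlinarith

theorem pow_sq (hw : IsNormOneChar p w) (x : K) : x ^ p ^ 2 = x := by
  have := hw.finite
  have := Fintype.ofFinite K
  have h := FiniteField.pow_card x
  rwa [← Nat.card_eq_fintype_card, hw.card_eq] at h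

theorem apply_pow (hw : IsNormOneChar p w) (i : ZMod q) : w i ^ p = w (-i) := by
  rw [← AddChar.map_nsmul_eq_pow, nsmul_eq_mul, hw.cast_eq, neg_one_mul]

theorem apply_ne_zero (w : AddChar (ZMod q) K) (i : ZMod q) : w i ≠ 0 := by
  intro h
  have h1 : w i * w (-i) = 1 := by
    rw [← AddChar.map_add_eq_mul, add_neg_cancel, AddChar.map_zero_eq_one]
  rw [h, zero_mul] at h1
  exact zero_ne_one h1

theorem apply_ne_one (hw : IsNormOneChar p w) {i : ZMod q} (hi : i ≠ 0) : w i ≠ 1 := by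
  intro h
  exact hi (hw.injective (by rw [h, AddChar.map_zero_eq_one]))

theorem one_sub_ne_zero (hw : IsNormOneChar p w) {i : ZMod q} (hi : i ≠ 0) : 1 - w i ≠ 0 :=
  sub_ne_zero.mpr (hw.apply_ne_one hi).symm

variable [Algebra (ZMod p) K]

theorem charP (p : ℕ) [Fact p.Prime] (K : Type u) [Field K] [Algebra (ZMod p) K] : CharP K p :=
  charP_of_injective_algebraMap (algebraMap (ZMod p) K).injective p

theorem algebraMap_pow (a : ZMod p) : algebraMap (ZMod p) K a ^ p = algebraMap (ZMod p) K a := by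
  rw [← map_pow, ZMod.pow_card]

theorem natCast_q_ne_zero (hw : IsNormOneChar p w) : (q : K) ≠ 0 := by
  have := charP p K
  rw [Ne, CharP.cast_eq_zero_iff K p, Nat.prime_dvd_prime_iff_eq Fact.out Fact.out]
  rintro rfl
  have h := hw.cast_eq
  rw [CharP.cast_eq_zero] at h
  exact one_ne_zero (neg_eq_zero.mp h.symm)

theorem apply_ne_algebraMap (hw : IsNormOneChar p w) {i : ZMod q} (hi : i ≠ 0) (a : ZMod p) :
    w i ≠ algebraMap (ZMod p) K a := by
  intro h
  have h1 := algebraMap_pow (K := K) a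
  rw [← h, hw.apply_pow] at h1
  exact hw.neg_ne_self hi (hw.injective h1)

theorem linComb_injective (hw : IsNormOneChar p w) {i : ZMod q} (hi : i ≠ 0) :
    Function.Injective fun v : ZMod p × ZMod p =>
      algebraMap (ZMod p) K v.1 + algebraMap (ZMod p) K v.2 * w i := by
  rintro ⟨a, b⟩ ⟨c, d⟩ h
  simp only at h
  have h1 : algebraMap (ZMod p) K (a - c) = algebraMap (ZMod p) K (d - b) * w i := by
    rw [map_sub, map_sub]; linear_combination h
  have hdb : d - b = 0 := by
    by_contra hne
    have hne' : algebraMap (ZMod p) K (d - b) ≠ 0 := by rwa [Ne, map_eq_zero]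
    apply hw.apply_ne_algebraMap hi ((a - c) / (d - b))
    rw [map_div₀, h1]
    field_simp
  rw [hdb, map_zero, zero_mul] at h1
  have hac : a - c = 0 := by rwa [map_eq_zero] at h1
  rw [sub_eq_zero.mp hac, sub_eq_zero.mp hdb]

/-- `1` and `w i` span the field over the prime field. -/
theorem exists_linComb (hw : IsNormOneChar p w) {i : ZMod q} (hi : i ≠ 0) (z : K) :
    ∃ a b : ZMod p, z = algebraMap (ZMod p) K a + algebraMap (ZMod p) K b * w i := by
  have := hw.finite
  have h := (hw.linComb_injective hi).bijective_of_nat_card_le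
    (by rw [hw.card_eq, Nat.card_prod, Nat.card_zmod, sq])
  obtain ⟨⟨a, b⟩, hab⟩ := h.2 z
  exact ⟨a, b, hab.symm⟩

theorem map_algebraMap_mul (T : K →+ K) (a : ZMod p) (x : K) :
    T (algebraMap (ZMod p) K a * x) = algebraMap (ZMod p) K a * T x := by
  rw [← Algebra.smul_def, ZMod.map_smul, Algebra.smul_def]

theorem map_linComb_mul {T : K →+ K} {i i' : ZMod q}
    (h : ∀ x, T (w i * x) = w i' * T x) (a b : ZMod p) (x : K) :
    T ((algebraMap (ZMod p) K a + algebraMap (ZMod p) K b * w i) * x) =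
      (algebraMap (ZMod p) K a + algebraMap (ZMod p) K b * w i') * T x := by
  rw [add_mul, map_add, map_algebraMap_mul, mul_assoc, map_algebraMap_mul, h]
  ring

/-- A non-zero additive map that intertwines multiplication by `w i` with multiplication by `w i'`
is linear or semilinear for the Frobenius automorphism. -/
theorem semilinear (hw : IsNormOneChar p w) {T : K →+ K} {i i' : ZMod q} (hi : i ≠ 0)
    (h : ∀ x, T (w i * x) = w i' * T x) (hT : T ≠ 0) :
    (i' = i ∧ ∀ x, T x = T 1 * x) ∨ (i' = -i ∧ ∀ x, T x = T 1 * x ^ p) := by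
  have := charP p K
  have hval : ∀ a b : ZMod p, T (algebraMap (ZMod p) K a + algebraMap (ZMod p) K b * w i) =
      T 1 * (algebraMap (ZMod p) K a + algebraMap (ZMod p) K b * w i') := by
    intro a b
    have := map_linComb_mul h a b 1
    rw [mul_one] at this
    rw [this, mul_comm]
  -- `w i` and `w i'` are roots of the same quadratic polynomial over the prime field
  have hii : i' = i ∨ i' = -i := by
    obtain ⟨x, hx⟩ : ∃ x, T x ≠ 0 := by
      by_contra! h0
      exact hT (AddMonoidHom.ext h0)
    obtain ⟨a, b, hab⟩ := hw.exists_linComb hi (w i * w i)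
    have h1 := map_linComb_mul h a b x
    rw [← hab, mul_assoc, h, h] at h1
    have h2 : w i' * w i' = algebraMap (ZMod p) K a + algebraMap (ZMod p) K b * w i' :=
      mul_right_cancel₀ hx (by rw [← h1]; ring)
    have h3 : w (-i) * w (-i) = algebraMap (ZMod p) K a + algebraMap (ZMod p) K b * w (-i) := by
      rw [← hw.apply_pow, ← mul_pow, hab, add_pow_char, mul_pow, algebraMap_pow, algebraMap_pow]
    have hne : w i ≠ w (-i) := fun h => hw.neg_ne_self hi (hw.injective h.symm)
    have hb : algebraMap (ZMod p) K b = w i + w (-i) :=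
      mul_right_cancel₀ (sub_ne_zero.mpr hne) (by linear_combination h3 - hab)
    have h4 : (w i' - w i) * (w i' - w (-i)) = 0 := by
      linear_combination h2 - hab + (w i' - w i) * hb
    rcases mul_eq_zero.mp h4 with h5 | h5
    · exact Or.inl (hw.injective (sub_eq_zero.mp h5))
    · exact Or.inr (hw.injective (sub_eq_zero.mp h5))
  rcases hii with hii | hii
  · refine Or.inl ⟨hii, fun x => ?_⟩
    obtain ⟨a, b, rfl⟩ := hw.exists_linComb hi x
    rw [hval, hii]
  · refine Or.inr ⟨hii, fun x => ?_⟩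
    obtain ⟨a, b, rfl⟩ := hw.exists_linComb hi x
    rw [hval, hii, add_pow_char, mul_pow, algebraMap_pow, algebraMap_pow, hw.apply_pow]

/-- Multiplication by `w i` acts irreducibly: the kernel of `T`, being stable under it, is trivial
or everything. -/
theorem eq_zero_or_injective {A : Type*} [AddCommGroup A] [Module (ZMod p) A]
    (hw : IsNormOneChar p w) {T : K →+ A} {i : ZMod q} (hi : i ≠ 0)
    (h : ∀ x, T x = 0 → T (w i * x) = 0) : T = 0 ∨ Function.Injective T := by
  by_cases hinj : Function.Injective T
  · exact Or.inr hinj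
  left
  rw [injective_iff_map_eq_zero] at hinj
  push Not at hinj
  obtain ⟨x, hx, hx0⟩ := hinj
  ext z
  obtain ⟨a, b, hab⟩ := hw.exists_linComb hi (z / x)
  have hz : z = a • x + b • (w i * x) := by
    rw [Algebra.smul_def, Algebra.smul_def, ← mul_assoc, ← add_mul, ← hab, div_mul_cancel₀ _ hx0]
  rw [hz, map_add, ZMod.map_smul, ZMod.map_smul, hx, h x hx]
  simp

/-- The case of Hilbert's Theorem 90 that is needed. -/
theorem exists_mul_pow_eq (hw : IsNormOneChar p w) {c : K} (hc : c ^ (p + 1) = 1) :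
    ∃ u : K, u ≠ 0 ∧ c * u ^ p = u := by
  have := charP p K
  have key : ∃ x : K, x + c * x ^ p ≠ 0 := by
    by_contra! h
    have h1 := h 1
    have hc1 : c = -1 := by rw [one_pow, mul_one] at h1; linear_combination h1
    have h2 := h (w 1)
    rw [hw.apply_pow, hc1] at h2
    refine hw.neg_ne_self one_ne_zero (hw.injective (?_ : w (-1) = w 1))
    linear_combination -h2
  obtain ⟨x, hx⟩ := key
  refine ⟨x + c * x ^ p, hx, ?_⟩
  rw [add_pow_char, mul_pow, ← pow_mul, ← sq, hw.pow_sq]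
  rw [pow_succ'] at hc
  linear_combination x * hc

theorem algebraMap_norm (hw : IsNormOneChar p w) (c : K) :
    algebraMap (ZMod p) K (Algebra.norm (ZMod p) c) = c ^ (p + 1) := by
  have := hw.finite
  have hp : 1 < p := (Fact.out : p.Prime).one_lt
  rw [FiniteField.algebraMap_norm_eq_pow, hw.card_eq, Nat.card_zmod,
    Nat.div_eq_of_eq_mul_left (by omega : 0 < p - 1)]
  rw [← Nat.sq_sub_sq, one_pow]

theorem exists_eq_of_pow_eq_one (hw : IsNormOneChar p w) {u : K} (hu : u ^ q = 1) :
    ∃ m, u = w m := by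
  have hprim : IsPrimitiveRoot (w 1) q := by
    refine IsPrimitiveRoot.mk_of_lt _ (Fact.out : q.Prime).pos ?_ ?_
    · rw [← AddChar.map_nsmul_eq_pow, nsmul_one, CharP.cast_eq_zero, AddChar.map_zero_eq_one]
    · intro l hl hlq
      rw [← AddChar.map_nsmul_eq_pow, nsmul_one]
      refine hw.apply_ne_one ?_
      rw [Ne, ZMod.natCast_eq_zero_iff]
      exact Nat.not_dvd_of_pos_of_lt hl hlq
  obtain ⟨i, -, hi⟩ := hprim.eq_pow_of_pow_eq_one hu
  exact ⟨i • 1, by rw [AddChar.map_nsmul_eq_pow, hi]⟩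

end IsNormOneChar

/-! ### The affine group `K ⋊ ℤ_q` -/

/-- The group of the affine maps `y ↦ w i * y + x` of a field `K`, for a character `w` of `ℤ_q`
with values in `K`. An element is recorded as the pair of `trans = x` and `rot = i`, so that the
group is the semidirect product of `K` and `ℤ_q` also when `w` is not injective. -/
@[ext]
structure AffGroup {q : ℕ} {K : Type u} [Field K] (w : AddChar (ZMod q) K) : Type u where
  trans : K
  rot : ZMod q

namespace AffGroup

section group

variable {q : ℕ} {K : Type u} [Field K] {w w' : AddChar (ZMod q) K}

theorem apply_mul_neg (w : AddChar (ZMod q) K) (i : ZMod q) : w i * w (-i) = 1 := by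
  rw [← AddChar.map_add_eq_mul, add_neg_cancel, AddChar.map_zero_eq_one]

instance : Mul (AffGroup w) := ⟨fun g h => ⟨g.trans + w g.rot * h.trans, g.rot + h.rot⟩⟩
instance : One (AffGroup w) := ⟨⟨0, 0⟩⟩
instance : Inv (AffGroup w) := ⟨fun g => ⟨-(w (-g.rot) * g.trans), -g.rot⟩⟩

@[simp] theorem trans_mul (g h : AffGroup w) : (g * h).trans = g.trans + w g.rot * h.trans := rfl
@[simp] theorem rot_mul (g h : AffGroup w) : (g * h).rot = g.rot + h.rot := rfl
@[simp] theorem trans_one : (1 : AffGroup w).trans = 0 := rfl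
@[simp] theorem rot_one : (1 : AffGroup w).rot = 0 := rfl
@[simp] theorem trans_inv (g : AffGroup w) : (g⁻¹).trans = -(w (-g.rot) * g.trans) := rfl
@[simp] theorem rot_inv (g : AffGroup w) : (g⁻¹).rot = -g.rot := rfl

instance : Group (AffGroup w) :=
  Group.ofLeftAxioms
    (fun g h k => by
      ext
      · simp [AddChar.map_add_eq_mul]; ring
      · simp [add_assoc])
    (fun g => by ext <;> simp)
    (fun g => by ext <;> simp)

/-- The underlying pair. -/
def equivProd (w : AddChar (ZMod q) K) : AffGroup w ≃ K × ZMod q where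
  toFun g := (g.trans, g.rot)
  invFun v := ⟨v.1, v.2⟩

theorem card_eq (w : AddChar (ZMod q) K) : Nat.card (AffGroup w) = Nat.card K * q := by
  rw [Nat.card_congr (equivProd w), Nat.card_prod, Nat.card_zmod]

/-- The homomorphism to the quotient `ℤ_q`. -/
def rotHom (w : AddChar (ZMod q) K) : AffGroup w →* Multiplicative (ZMod q) where
  toFun g := .ofAdd g.rot
  map_one' := rfl
  map_mul' _ _ := rfl

@[simp] theorem rot_pow (g : AffGroup w) (n : ℕ) : (g ^ n).rot = n * g.rot := by
  induction n with
  | zero => simp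
  | succ n ih => rw [pow_succ, rot_mul, ih]; push_cast; ring

theorem mk_zero_pow (x : K) (n : ℕ) : (⟨x, 0⟩ : AffGroup w) ^ n = ⟨n * x, 0⟩ := by
  induction n with
  | zero => ext <;> simp
  | succ n ih => rw [pow_succ, ih]; ext <;> simp; ring

theorem zero_mk_pow (i : ZMod q) (n : ℕ) : (⟨0, i⟩ : AffGroup w) ^ n = ⟨0, n * i⟩ := by
  induction n with
  | zero => ext <;> simp
  | succ n ih => rw [pow_succ, ih]; ext <;> simp; ring

theorem conj_mk_zero (t : K) (g : AffGroup w) :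
    (⟨t, 0⟩ : AffGroup w) * g * (⟨t, 0⟩ : AffGroup w)⁻¹ =
      ⟨g.trans + (1 - w g.rot) * t, g.rot⟩ := by
  ext <;> simp; ring

/-- The elements with the fixed point `t` are the conjugates, under translation by `t`, of the
elements with fixed point `0`. -/
theorem conj_mk_zero_of_fixed (t : K) (g : AffGroup w) (h : g.trans = (1 - w g.rot) * t) :
    (⟨-t, 0⟩ : AffGroup w) * g * (⟨-t, 0⟩ : AffGroup w)⁻¹ = ⟨0, g.rot⟩ := by
  rw [conj_mk_zero, h]; ext <;> simp

/-- A map between affine groups given by an additive map of the translation parts and a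
multiplication of the rotation parts. -/
def map (f : K →+ K) (r : ZMod q) (h : ∀ i x, f (w i * x) = w' (r * i) * f x) :
    AffGroup w →* AffGroup w' where
  toFun g := ⟨f g.trans, r * g.rot⟩
  map_one' := by ext <;> simp
  map_mul' g k := by
    ext
    · simp [h]
    · simp [mul_add]

/-- Scaling of the translation part by a non-zero element of the field. -/
def scale (w : AddChar (ZMod q) K) (u : Kˣ) : AffGroup w ≃* AffGroup w where
  toFun g := ⟨u * g.trans, g.rot⟩
  invFun g := ⟨↑u⁻¹ * g.trans, g.rot⟩
  left_inv g := by ext <;> simp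
  right_inv g := by ext <;> simp
  map_mul' g h := by ext <;> simp; ring

@[simp] theorem scale_apply (u : Kˣ) (g : AffGroup w) : scale w u g = ⟨u * g.trans, g.rot⟩ := rfl

end group

section lift

variable {q : ℕ} [NeZero q] {K : Type u} [Field K] {w : AddChar (ZMod q) K}

theorem eq_mul_pow (g : AffGroup w) :
    g = ⟨g.trans, 0⟩ * (⟨0, 1⟩ : AffGroup w) ^ g.rot.val := by
  rw [zero_mk_pow]; ext <;> simp

theorem hom_ext {M : Type*} [Monoid M] {f f' : AffGroup w →* M}
    (h1 : ∀ x, f ⟨x, 0⟩ = f' ⟨x, 0⟩) (h2 : f ⟨0, 1⟩ = f' ⟨0, 1⟩) : f = f' := by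
  ext g
  rw [eq_mul_pow g, map_mul, map_mul, map_pow, map_pow, h1, h2]

/-- The homomorphism from the affine group that is given on `K` and on the rotation `1`. -/
def lift {M : Type*} [Group M] (e : Multiplicative K →* M) (m : M) (hm : m ^ q = 1)
    (h : ∀ x : K, m * e (.ofAdd x) * m⁻¹ = e (.ofAdd (w 1 * x))) : AffGroup w →* M where
  toFun g := e (.ofAdd g.trans) * m ^ g.rot.val
  map_one' := by simp
  map_mul' g k := by
    have hpow : ∀ (n : ℕ) (x : K), m ^ n * e (.ofAdd x) * (m ^ n)⁻¹ = e (.ofAdd (w n * x)) := by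
      intro n
      induction n with
      | zero => intro x; simp
      | succ n ih =>
        intro x
        rw [pow_succ, _root_.mul_inv_rev, Nat.cast_succ, AddChar.map_add_eq_mul,
          mul_assoc (w _), ← ih, ← h]
        group
    have h1 := hpow g.rot.val k.trans
    rw [ZMod.natCast_zmod_val, mul_inv_eq_iff_eq_mul] at h1
    have h2 : m ^ (g.rot + k.rot).val = m ^ g.rot.val * m ^ k.rot.val := by
      rw [ZMod.val_add, ← pow_add]
      exact (pow_eq_pow_mod _ hm).symm
    rw [trans_mul, rot_mul, ofAdd_add, map_mul, h2, mul_assoc, ← mul_assoc (e (.ofAdd (w _ * _))),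
      ← h1]
    simp only [mul_assoc]

end lift

section automorphisms

variable {p q : ℕ} [Fact p.Prime] [Fact q.Prime] {K : Type u} [Field K]
  {w : AddChar (ZMod q) K}

theorem card_of_isNormOneChar (hw : IsNormOneChar p w) (w' : AddChar (ZMod q) K) :
    Nat.card (AffGroup w') = p ^ 2 * q := by
  rw [card_eq, hw.card_eq]

theorem finite (hw : IsNormOneChar p w) (w' : AddChar (ZMod q) K) : Finite (AffGroup w') := by
  have := hw.finite
  exact Finite.of_equiv _ (equivProd w').symm

theorem conj_injective (hw : IsNormOneChar p w) :
    Function.Injective (MulAut.conj : AffGroup w →* MulAut (AffGroup w)) := by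
  rw [injective_iff_map_eq_one]
  intro g hg
  have h1 := DFunLike.congr_fun hg (⟨1, 0⟩ : AffGroup w)
  have h2 := DFunLike.congr_fun hg (⟨0, 1⟩ : AffGroup w)
  rw [MulAut.conj_apply, MulAut.one_apply, mul_inv_eq_iff_eq_mul] at h1 h2
  have h3 := congrArg trans h1
  have h4 := congrArg trans h2
  simp only [trans_mul, mul_one, mul_zero, AddChar.map_zero_eq_one, one_mul, zero_add,
    add_zero] at h3 h4
  have h5 : g.rot = 0 := by
    by_contra h0
    exact hw.apply_ne_one h0 (by linear_combination h3)
  have h6 : g.trans = 0 := by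
    have h7 : (1 - w 1) * g.trans = 0 := by linear_combination h4
    exact (mul_eq_zero.mp h7).resolve_left (hw.one_sub_ne_zero one_ne_zero)
  ext
  · exact h6
  · exact h5

variable [Algebra (ZMod p) K]

theorem natCast_p_ne_zero (hw : IsNormOneChar p w) : (p : ZMod q) ≠ 0 := by
  rw [hw.cast_eq]
  exact neg_ne_zero.mpr one_ne_zero

/-- A homomorphism to `ℤ_q` kills the translations, as `p` and `q` are coprime. -/
theorem rot_hom_mk_zero (hw : IsNormOneChar p w) {w₁ w₂ : AddChar (ZMod q) K}
    (f : AffGroup w₁ →* AffGroup w₂) (x : K) : (f ⟨x, 0⟩).rot = 0 := by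
  have := IsNormOneChar.charP p K
  have h : (f ⟨x, 0⟩ ^ p).rot = 0 := by
    rw [← map_pow, mk_zero_pow, CharP.cast_eq_zero, zero_mul]
    exact congrArg rot (map_one f)
  rw [rot_pow] at h
  exact (mul_eq_zero.mp h).resolve_left (natCast_p_ne_zero hw)

theorem rot_hom (hw : IsNormOneChar p w) {w₁ w₂ : AddChar (ZMod q) K}
    (f : AffGroup w₁ →* AffGroup w₂) (g : AffGroup w₁) :
    (f g).rot = (f ⟨0, 1⟩).rot * g.rot := by
  conv_lhs => rw [eq_mul_pow g]
  rw [map_mul, rot_mul, rot_hom_mk_zero hw, map_pow, rot_pow, zero_add, ZMod.natCast_zmod_val,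
    mul_comm]

/-- The restriction of an endomorphism of the affine group to the translations. -/
def transHom (hw : IsNormOneChar p w) (f : AffGroup w →* AffGroup w) : K →+ K where
  toFun x := (f ⟨x, 0⟩).trans
  map_zero' := congrArg trans (map_one f)
  map_add' x y := by
    have h : (⟨x + y, 0⟩ : AffGroup w) = ⟨x, 0⟩ * ⟨y, 0⟩ := by ext <;> simp
    rw [h, map_mul, trans_mul, rot_hom_mk_zero hw]
    simp

theorem hom_mk_zero (hw : IsNormOneChar p w) (f : AffGroup w →* AffGroup w) (x : K) :
    f ⟨x, 0⟩ = ⟨transHom hw f x, 0⟩ :=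
  AffGroup.ext rfl (rot_hom_mk_zero hw f x)

theorem transHom_apply_mul (hw : IsNormOneChar p w) (f : AffGroup w →* AffGroup w) (i : ZMod q)
    (x : K) : transHom hw f (w i * x) = w ((f ⟨0, 1⟩).rot * i) * transHom hw f x := by
  have h : (⟨w i * x, 0⟩ : AffGroup w) = ⟨0, i⟩ * ⟨x, 0⟩ * ⟨0, i⟩⁻¹ := by ext <;> simp
  have h1 := congrArg trans (congrArg f h)
  have h2 : (f ⟨0, i⟩).rot = (f ⟨0, 1⟩).rot * i := rot_hom hw f _
  rw [map_mul, map_mul, map_inv, hom_mk_zero hw, hom_mk_zero hw] at h1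
  simp only [trans_mul, trans_inv, rot_mul, add_zero, h2] at h1
  rw [h1]
  linear_combination (-(f ⟨0, i⟩).trans) * apply_mul_neg w ((f ⟨0, 1⟩).rot * i)

theorem rot_mulEquiv_ne_zero (hw : IsNormOneChar p w) (θ : AffGroup w ≃* AffGroup w) :
    (θ ⟨0, 1⟩).rot ≠ 0 := by
  intro h
  have h1 := rot_hom hw θ.toMonoidHom (θ.symm ⟨0, 1⟩)
  simp [h] at h1

theorem transHom_mulEquiv_injective (hw : IsNormOneChar p w) (θ : AffGroup w ≃* AffGroup w) :
    Function.Injective (transHom hw θ.toMonoidHom) := by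
  intro x y h
  have h1 : θ.toMonoidHom ⟨x, 0⟩ = θ.toMonoidHom ⟨y, 0⟩ := by
    rw [hom_mk_zero hw, hom_mk_zero hw, h]
  exact congrArg trans (θ.injective h1)

/-- Automorphisms whose order divides `p² q` are inner. -/
theorem exists_conj_of_pow_eq_one (hw : IsNormOneChar p w) (θ : MulAut (AffGroup w))
    (hθ : θ ^ (p ^ 2 * q) = 1) : ∃ b, MulAut.conj b = θ := by
  have hodd : Odd (p ^ 2 * q) :=
    (((Fact.out : p.Prime).odd_of_ne_two hw.p_ne_two).pow).mul
      ((Fact.out : q.Prime).odd_of_ne_two hw.q_ne_two)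
  set T := transHom hw θ.toMonoidHom with hTdef
  set k := (θ ⟨0, 1⟩).rot with hk
  have hT0 : T ≠ 0 := by
    intro h
    have := transHom_mulEquiv_injective hw θ (a₁ := 1) (a₂ := 0)
    rw [← hTdef, h] at this
    exact one_ne_zero (this rfl)
  have hT : ∀ x, T (w 1 * x) = w k * T x := by
    intro x
    have h := transHom_apply_mul hw θ.toMonoidHom 1 x
    rwa [mul_one] at h
  -- the action of `θ` on the quotient `ℤ_q` is by `1` or `-1`, and has odd order
  have hkpow : ∀ n : ℕ, ((θ ^ n) ⟨0, 1⟩).rot = k ^ n := by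
    intro n
    induction n with
    | zero => simp
    | succ n ih =>
      rw [pow_succ', MulAut.mul_apply]
      have h := rot_hom hw θ.toMonoidHom ((θ ^ n) ⟨0, 1⟩)
      rw [ih] at h
      rw [pow_succ']
      exact h
  have hk1 := hkpow (p ^ 2 * q)
  rw [hθ, MulAut.one_apply] at hk1
  rcases hw.semilinear one_ne_zero hT hT0 with ⟨hk', hlin⟩ | ⟨hk', -⟩
  swap
  · rw [hk', hodd.neg_one_pow] at hk1
    exact absurd hk1.symm (hw.neg_ne_self one_ne_zero)
  set c := T 1 with hc
  have hcpow : ∀ n : ℕ, (θ ^ n) ⟨1, 0⟩ = ⟨c ^ n, 0⟩ := by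
    intro n
    induction n with
    | zero => simp
    | succ n ih =>
      rw [pow_succ', MulAut.mul_apply, ih]
      have h := hom_mk_zero hw θ.toMonoidHom (c ^ n)
      rw [← hTdef, hlin, ← pow_succ'] at h
      exact h
  have hc1 := hcpow (p ^ 2 * q)
  rw [hθ, MulAut.one_apply] at hc1
  have hc2 : c ^ q = 1 := by
    have h := congrArg trans hc1
    simp only at h
    rw [mul_comm, pow_mul, hw.pow_sq] at h
    exact h.symm
  obtain ⟨m, hm⟩ := hw.exists_eq_of_pow_eq_one hc2
  have h1 := hw.one_sub_ne_zero (one_ne_zero (α := ZMod q))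
  obtain ⟨t, ht⟩ : ∃ t, (θ ⟨0, 1⟩).trans = (1 - w 1) * t :=
    ⟨(θ ⟨0, 1⟩).trans / (1 - w 1), by rw [mul_div_cancel₀ _ h1]⟩
  refine ⟨⟨t, m⟩, ?_⟩
  apply MulEquiv.toMonoidHom_injective
  refine hom_ext (fun x => ?_) ?_
  · rw [hom_mk_zero hw θ.toMonoidHom, ← hTdef, hlin, hm]
    change (_ : AffGroup w) * _ * _ = _
    ext
    · simp
      linear_combination (-t) * apply_mul_neg w m
    · simp
  · change (_ : AffGroup w) * _ * _ = θ ⟨0, 1⟩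
    ext
    · simp only [trans_mul, rot_mul, trans_inv, mul_zero, add_zero, AddChar.map_add_eq_mul, ht]
      linear_combination (-(w 1 * t)) * apply_mul_neg w m
    · simp [← hk, hk']

/-- An element of order dividing `q` has a fixed point. -/
theorem exists_fixed (hw : IsNormOneChar p w) (g : AffGroup w) (hg : g ^ q = 1) :
    ∃ t, g.trans = (1 - w g.rot) * t := by
  by_cases h : g.rot = 0
  · have h1 : g = ⟨g.trans, 0⟩ := AffGroup.ext rfl h
    rw [h1, mk_zero_pow] at hg
    have h2 := congrArg trans hg
    simp only [trans_one] at h2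
    rw [(mul_eq_zero.mp h2).resolve_left hw.natCast_q_ne_zero]
    exact ⟨0, by simp⟩
  · exact ⟨g.trans / (1 - w g.rot), by rw [mul_div_cancel₀ _ (hw.one_sub_ne_zero h)]⟩

end automorphisms

end AffGroup

/-! ### Skew braces and regular pairs of homomorphisms -/

/-- The homomorphisms `a, b : (B, ∘) → G` realize the skew brace `B` if `x ↦ a x * (b x)⁻¹` is an
isomorphism from `(B, +)` to `G`. Then `(a, b)` embeds `(B, ∘)` as a regular subgroup of the
holomorph of `G`, where `(g, h)` acts on `G` by `y ↦ g * y * h⁻¹`. -/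
structure SkewBrace.IsRealizedBy {B : Type u} [SkewBrace B] {G : Type*} [Group G] (a b : B →* G) :
    Prop where
  bijective : Function.Bijective fun x => a x * (b x)⁻¹
  map_add : ∀ x y, a (x + y) * (b (x + y))⁻¹ = a x * (b x)⁻¹ * (a y * (b y)⁻¹)

namespace SkewBrace.IsRealizedBy

variable {B B' : Type u} [SkewBrace B] [SkewBrace B'] {G : Type*} [Group G]
  {a b : B →* G} {a' b' : B' →* G}

/-- The isomorphism from the additive group. -/
noncomputable def addEquiv (h : IsRealizedBy a b) : B ≃+ Additive G where
  toEquiv := (Equiv.ofBijective _ h.bijective).trans Additive.ofMul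
  map_add' := h.map_add

theorem ext_pair (h : IsRealizedBy a b) {x y : B} (h1 : a x = a y) (h2 : b x = b y) : x = y :=
  h.bijective.1 (by simp only [h1, h2])

/-- In terms of the isomorphism with `G`, the automorphism `λ_x` is conjugation by `b x`. -/
theorem lam_eq (h : IsRealizedBy a b) (x y : B) :
    a ((lam B x).toAdd y) * (b ((lam B x).toAdd y))⁻¹ = MulAut.conj (b x) (a y * (b y)⁻¹) := by
  have h1 := h.map_add x ((lam B x).toAdd y)
  rw [lam_apply, add_neg_cancel_left, map_mul, map_mul] at h1
  rw [lam_apply, MulAut.conj_apply]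
  rw [← inv_mul_eq_iff_eq_mul.mpr h1]
  group

theorem ker_lam (h : IsRealizedBy a b) (hG : Function.Injective (MulAut.conj : G →* MulAut G)) :
    (lam B).ker = b.ker := by
  ext x
  rw [MonoidHom.mem_ker, MonoidHom.mem_ker]
  constructor
  · intro hx
    apply hG
    rw [map_one]
    ext g
    obtain ⟨y, rfl⟩ := h.bijective.2 g
    simp only
    rw [← h.lam_eq, hx]
    rfl
  · intro hx
    apply Multiplicative.toAdd.injective
    ext y
    apply h.bijective.1
    simp only
    rw [h.lam_eq, hx, map_one]
    rfl

/-- Two realized skew braces are isomorphic if an automorphism of `G` takes the image of one pair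
into the image of the other. -/
theorem nonempty_ringEquiv (h : IsRealizedBy a b) (h' : IsRealizedBy a' b') (θ : G ≃* G)
    (f : B → B') (ha : ∀ x, a' (f x) = θ (a x)) (hb : ∀ x, b' (f x) = θ (b x)) :
    Nonempty (B ≃+* B') := by
  have hf : ∀ x, a' (f x) * (b' (f x))⁻¹ = θ (a x * (b x)⁻¹) := fun x => by
    rw [ha, hb, map_mul, map_inv]
  refine ⟨RingEquiv.mk (Equiv.ofBijective f ⟨fun x y hxy => ?_, fun y => ?_⟩)
    (fun x y => ?_) (fun x y => ?_)⟩
  · apply h.bijective.1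
    apply θ.injective
    simp only
    rw [← hf, ← hf, hxy]
  · obtain ⟨x, hx⟩ := h.bijective.2 (θ.symm (a' y * (b' y)⁻¹))
    refine ⟨x, h'.bijective.1 ?_⟩
    simp only at hx ⊢
    rw [hf, hx, MulEquiv.apply_symm_apply]
  · change f (x * y) = f x * f y
    exact h'.ext_pair (by simp only [ha, map_mul]) (by simp only [hb, map_mul])
  · change f (x + y) = f x + f y
    apply h'.bijective.1
    simp only
    rw [hf, h'.map_add, h.map_add, map_mul, hf, hf]

/-- Isomorphisms of skew braces realized in a group without centre come from an automorphism of
that group. -/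
theorem exists_mulEquiv (h : IsRealizedBy a b) (h' : IsRealizedBy a' b')
    (hG : Function.Injective (MulAut.conj : G →* MulAut G)) (f : B ≃+* B') :
    ∃ θ : G ≃* G, (∀ x, a' (f x) = θ (a x)) ∧ ∀ x, b' (f x) = θ (b x) := by
  let θ : G ≃* G := AddEquiv.toMultiplicative
    ((h.addEquiv.symm.trans f.toAddEquiv).trans h'.addEquiv)
  have hθ : ∀ x, θ (a x * (b x)⁻¹) = a' (f x) * (b' (f x))⁻¹ := by
    intro x
    change h'.addEquiv (f (h.addEquiv.symm (h.addEquiv x))) = _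
    rw [AddEquiv.symm_apply_apply]
    rfl
  have hlam : ∀ x y, f ((lam B x).toAdd y) = (lam B' (f x)).toAdd (f y) := by
    intro x y
    simp [lam_apply]
  have hb : ∀ x, b' (f x) = θ (b x) := by
    intro x
    apply hG
    ext g
    obtain ⟨g, rfl⟩ := θ.surjective g
    obtain ⟨y, rfl⟩ := h.bijective.2 g
    simp only
    rw [hθ, ← h'.lam_eq, ← hlam, ← hθ, h.lam_eq, MulAut.conj_apply, MulAut.conj_apply, map_mul,
      map_mul, map_inv, hθ]
  refine ⟨θ, fun x => ?_, hb⟩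
  have h1 := hθ x
  rw [map_mul, map_inv, hb, mul_left_inj] at h1
  exact h1.symm

end SkewBrace.IsRealizedBy

/-- A pair of homomorphisms for which `m ↦ a m * (b m)⁻¹` is bijective makes its domain a skew
brace: the addition is the operation of `G`, transported along this bijection. -/
noncomputable abbrev SkewBrace.ofPair {M G : Type*} [Group M] [Group G] (a b : M →* G)
    (h : Function.Bijective fun m => a m * (b m)⁻¹) : SkewBrace M :=
  { ((Equiv.ofBijective _ h).trans Additive.ofMul).addGroup, ‹Group M› with
    mul_add_eq := by
      let := ((Equiv.ofBijective _ h).trans Additive.ofMul).addGroup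
      have hadd : ∀ x y : M, a (x + y) * (b (x + y))⁻¹ = a x * (b x)⁻¹ * (a y * (b y)⁻¹) :=
        fun x y => (Equiv.ofBijective _ h).apply_symm_apply _
      have hsub : ∀ x y : M, a (x - y) * (b (x - y))⁻¹ = a x * (b x)⁻¹ * (a y * (b y)⁻¹)⁻¹ := by
        intro x y
        rw [eq_mul_inv_iff_mul_eq, ← hadd, sub_add_cancel]
      intro x y z
      apply h.1
      simp only
      rw [hadd, hsub, map_mul, map_mul, map_mul, map_mul, map_mul, map_mul]
      have h2 := hadd y z
      rw [mul_inv_eq_iff_eq_mul] at h2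
      rw [h2]
      group }

/-- The skew brace of a regular pair, bundled. -/
noncomputable def BundledSkewBrace.ofPair {M : Type u} {G : Type*} [Group M] [Group G]
    (a b : M →* G) (h : Function.Bijective fun m => a m * (b m)⁻¹) : BundledSkewBrace.{u} :=
  @BundledSkewBrace.mk M (SkewBrace.ofPair a b h)

/-- The multiplicative group of the skew brace of a regular pair is the domain of the pair. -/
noncomputable def BundledSkewBrace.mulEquivOfPair {M : Type u} {G : Type*} [Group M] [Group G]
    (a b : M →* G) (h : Function.Bijective fun m => a m * (b m)⁻¹) :
    BundledSkewBrace.ofPair a b h ≃* M where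
  toFun x := x
  invFun x := x
  left_inv _ := rfl
  right_inv _ := rfl
  map_mul' _ _ := rfl

theorem BundledSkewBrace.isRealizedBy_ofPair {M : Type u} {G : Type*} [Group M] [Group G]
    (a b : M →* G) (h : Function.Bijective fun m => a m * (b m)⁻¹) :
    SkewBrace.IsRealizedBy (a.comp (mulEquivOfPair a b h).toMonoidHom)
      (b.comp (mulEquivOfPair a b h).toMonoidHom) :=
  @SkewBrace.IsRealizedBy.mk M (SkewBrace.ofPair a b h) G _ a b h
    (fun _ _ => (Equiv.ofBijective _ h).apply_symm_apply _)

section realize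

variable {p q : ℕ} [Fact p.Prime] [Fact q.Prime] {K : Type u} [Field K] [Algebra (ZMod p) K]
  {w : AddChar (ZMod q) K}

/-- Every skew brace whose additive group is the affine group is realized by a pair of
homomorphisms: the automorphisms `λ_x` have order dividing `p² q`, so they are inner. -/
theorem SkewBrace.exists_isRealizedBy (hw : IsNormOneChar p w) {B : Type u} [SkewBrace B]
    (e : B ≃+ Additive (AffGroup w)) : ∃ a b : B →* AffGroup w, IsRealizedBy a b := by
  have hconj := AffGroup.conj_injective hw
  have hcard : Nat.card B = p ^ 2 * q := by
    rw [Nat.card_congr (e.toEquiv.trans Additive.toMul), AffGroup.card_of_isNormOneChar hw]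
  let E : B ≃ AffGroup w := e.toEquiv.trans Additive.toMul
  have hE : ∀ x y, E (x + y) = E x * E y := fun x y => e.map_add x y
  let α : B →* MulAut (AffGroup w) := MonoidHom.mk'
    (fun x => AddEquiv.toMultiplicative ((e.symm.trans (lam B x).toAdd).trans e))
    (fun x y => by
      ext1 g
      change e ((lam B (x * y)).toAdd (e.symm g)) =
        e ((lam B x).toAdd (e.symm (e ((lam B y).toAdd (e.symm g)))))
      rw [map_mul, AddEquiv.symm_apply_apply]
      rfl)
  have hα : ∀ x y, α x (E y) = E ((lam B x).toAdd y) := by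
    intro x y
    change e ((lam B x).toAdd (e.symm (e y))) = _
    rw [AddEquiv.symm_apply_apply]
    rfl
  have hrange : ∀ x, α x ∈ (MulAut.conj : AffGroup w →* MulAut (AffGroup w)).range := by
    intro x
    apply AffGroup.exists_conj_of_pow_eq_one hw
    rw [← map_pow, ← hcard, pow_card_eq_one', map_one]
  let b : B →* AffGroup w :=
    (MonoidHom.ofInjective hconj).symm.toMonoidHom.comp (α.codRestrict _ hrange)
  have hb : ∀ x, MulAut.conj (b x) = α x := by
    intro x
    exact congrArg Subtype.val
      ((MonoidHom.ofInjective hconj).apply_symm_apply (α.codRestrict _ hrange x))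
  have hmul : ∀ x y, E (x * y) = E x * (b x * E y * (b x)⁻¹) := by
    intro x y
    rw [← MulAut.conj_apply, hb, hα, ← hE, lam_apply, add_neg_cancel_left]
  let a : B →* AffGroup w := MonoidHom.mk' (fun x => E x * b x) (fun x y => by
    rw [hmul, map_mul]; group)
  have hab : ∀ x, a x * (b x)⁻¹ = E x := fun x => mul_inv_cancel_right _ _
  refine ⟨a, b, ⟨?_, ?_⟩⟩
  · rw [show (fun x => a x * (b x)⁻¹) = E from funext hab]
    exact E.bijective
  · intro x y
    rw [hab, hab, hab, hE]

end realize

/-! ### Pairs of homomorphisms in normal form -/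

/-- A pair of homomorphisms from an affine group `K ⋊ ℤ_q`, in which `i` acts on `K` by
`w (act * i)`, to the affine group of `w`: the first is `(x, i) ↦ (left x, (rot + 1) * i)`, the
second is `(x, i) ↦ (right x, rot * i)`. The condition `eq_zero` says that the pair is regular. -/
structure PairDatum {q : ℕ} {K : Type u} [Field K] (w : AddChar (ZMod q) K) where
  rot : ZMod q
  act : ZMod q
  left : K →+ K
  right : K →+ K
  left_mul : ∀ i x, left (w (act * i) * x) = w ((rot + 1) * i) * left x
  right_mul : ∀ i x, right (w (act * i) * x) = w (rot * i) * right x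
  eq_zero : ∀ i x, left x = w i * right x → x = 0

namespace PairDatum

variable {p q : ℕ} [Fact p.Prime] [Fact q.Prime] {K : Type u} [Field K]
  {w : AddChar (ZMod q) K}

/-- The first homomorphism. -/
def leftHom (D : PairDatum w) : AffGroup (w.mulShift D.act) →* AffGroup w :=
  AffGroup.map D.left (D.rot + 1) (fun i x => by rw [AddChar.mulShift_apply, D.left_mul])

/-- The second homomorphism. -/
def rightHom (D : PairDatum w) : AffGroup (w.mulShift D.act) →* AffGroup w :=
  AffGroup.map D.right D.rot (fun i x => by rw [AddChar.mulShift_apply, D.right_mul])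

theorem leftHom_apply (D : PairDatum w) (g : AffGroup (w.mulShift D.act)) :
    D.leftHom g = ⟨D.left g.trans, (D.rot + 1) * g.rot⟩ := rfl

theorem rightHom_apply (D : PairDatum w) (g : AffGroup (w.mulShift D.act)) :
    D.rightHom g = ⟨D.right g.trans, D.rot * g.rot⟩ := rfl

theorem leftHom_mul_inv (D : PairDatum w) (g : AffGroup (w.mulShift D.act)) :
    D.leftHom g * (D.rightHom g)⁻¹ = ⟨D.left g.trans - w g.rot * D.right g.trans, g.rot⟩ := by
  rw [mul_inv_eq_iff_eq_mul, leftHom_apply, rightHom_apply]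
  ext
  · simp
  · simp; ring

theorem bijective (D : PairDatum w) (hw : IsNormOneChar p w) :
    Function.Bijective fun g => D.leftHom g * (D.rightHom g)⁻¹ := by
  have := AffGroup.finite hw w
  have hinj : Function.Injective fun g => D.leftHom g * (D.rightHom g)⁻¹ := by
    intro g h hgh
    simp only [leftHom_mul_inv, AffGroup.mk.injEq] at hgh
    obtain ⟨h1, h2⟩ := hgh
    refine AffGroup.ext (sub_eq_zero.mp (D.eq_zero g.rot _ ?_)) h2
    rw [map_sub, map_sub]
    rw [← h2] at h1
    linear_combination h1
  exact hinj.bijective_of_nat_card_le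
    (by rw [AffGroup.card_of_isNormOneChar hw, AffGroup.card_of_isNormOneChar hw])

/-- The skew brace of a pair in normal form. -/
noncomputable def brace (D : PairDatum w) (hw : IsNormOneChar p w) : BundledSkewBrace.{u} :=
  .ofPair D.leftHom D.rightHom (D.bijective hw)

/-- The multiplicative group of the skew brace of a pair is the domain of the pair. -/
noncomputable def mulEquiv (D : PairDatum w) (hw : IsNormOneChar p w) :
    D.brace hw ≃* AffGroup (w.mulShift D.act) :=
  BundledSkewBrace.mulEquivOfPair _ _ (D.bijective hw)

/-- The first homomorphism, on the skew brace. -/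
noncomputable def braceLeft (D : PairDatum w) (hw : IsNormOneChar p w) : D.brace hw →* AffGroup w :=
  D.leftHom.comp (D.mulEquiv hw).toMonoidHom

/-- The second homomorphism, on the skew brace. -/
noncomputable def braceRight (D : PairDatum w) (hw : IsNormOneChar p w) :
    D.brace hw →* AffGroup w :=
  D.rightHom.comp (D.mulEquiv hw).toMonoidHom

theorem braceLeft_apply (D : PairDatum w) (hw : IsNormOneChar p w) (x : D.brace hw) :
    D.braceLeft hw x =
      ⟨D.left (D.mulEquiv hw x).trans, (D.rot + 1) * (D.mulEquiv hw x).rot⟩ := rfl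

theorem braceRight_apply (D : PairDatum w) (hw : IsNormOneChar p w) (x : D.brace hw) :
    D.braceRight hw x = ⟨D.right (D.mulEquiv hw x).trans, D.rot * (D.mulEquiv hw x).rot⟩ := rfl

theorem isRealizedBy (D : PairDatum w) (hw : IsNormOneChar p w) :
    SkewBrace.IsRealizedBy (D.braceLeft hw) (D.braceRight hw) :=
  BundledSkewBrace.isRealizedBy_ofPair _ _ _

theorem cardKer_brace (D : PairDatum w) (hw : IsNormOneChar p w) :
    (D.brace hw).cardKer =
      Nat.card {x // D.right x = 0} * Nat.card {i : ZMod q // D.rot * i = 0} := by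
  rw [BundledSkewBrace.cardKer, (D.isRealizedBy hw).ker_lam (AffGroup.conj_injective hw),
    ← Nat.card_prod]
  have hmem : ∀ x : D.brace hw, D.braceRight hw x = 1 ↔
      D.right (D.mulEquiv hw x).trans = 0 ∧ D.rot * (D.mulEquiv hw x).rot = 0 := fun x => by
    rw [braceRight_apply, AffGroup.ext_iff]; rfl
  exact Nat.card_congr
    { toFun := fun g => ⟨⟨_, ((hmem g.1).mp g.2).1⟩, ⟨_, ((hmem g.1).mp g.2).2⟩⟩
      invFun := fun v => ⟨(D.mulEquiv hw).symm ⟨v.1.1, v.2.1⟩, (hmem _).mpr ⟨v.1.2, v.2.2⟩⟩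
      left_inv := fun _ => rfl
      right_inv := fun _ => rfl }

variable [Algebra (ZMod p) K]

theorem rot_eq_of_iso (hw : IsNormOneChar p w) {D D' : PairDatum w}
    (f : D.brace hw ≃+* D'.brace hw) : D.rot = D'.rot := by
  obtain ⟨θ, ha, hb⟩ := (D.isRealizedBy hw).exists_mulEquiv (D'.isRealizedBy hw)
    (AffGroup.conj_injective hw) f
  obtain ⟨g, hg⟩ := (D.mulEquiv hw).surjective ⟨0, 1⟩
  have hl : D.braceLeft hw g = ⟨0, D.rot + 1⟩ := by simp [braceLeft_apply, hg]
  have hr : D.braceRight hw g = ⟨0, D.rot⟩ := by simp [braceRight_apply, hg]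
  have h1 : (D'.rot + 1) * (D'.mulEquiv hw (f g)).rot = (θ ⟨0, 1⟩).rot * (D.rot + 1) := by
    have h := AffGroup.rot_hom hw θ.toMonoidHom (D.braceLeft hw g)
    rw [hl] at h
    refine Eq.trans ?_ h
    have h' := congrArg AffGroup.rot (ha g)
    rwa [hl, braceLeft_apply] at h'
  have h2 : D'.rot * (D'.mulEquiv hw (f g)).rot = (θ ⟨0, 1⟩).rot * D.rot := by
    have h := AffGroup.rot_hom hw θ.toMonoidHom (D.braceRight hw g)
    rw [hr] at h
    refine Eq.trans ?_ h
    have h' := congrArg AffGroup.rot (hb g)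
    rwa [hr, braceRight_apply] at h'
  apply mul_left_cancel₀ (AffGroup.rot_mulEquiv_ne_zero hw θ)
  linear_combination D'.rot * (h1 - h2) - h2

/-- An isomorphism between the skew braces of two pairs that are the identity in the second
component intertwines the maps in the first component. -/
theorem exists_intertwining (hw : IsNormOneChar p w) {D D' : PairDatum w}
    (hD : ∀ x, D.right x = x) (hD' : ∀ x, D'.right x = x) (f : D.brace hw ≃+* D'.brace hw) :
    ∃ T : K →+ K, Function.Injective T ∧ ∀ x, D'.left (T x) = T (D.left x) := by
  obtain ⟨θ, ha, hb⟩ := (D.isRealizedBy hw).exists_mulEquiv (D'.isRealizedBy hw)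
    (AffGroup.conj_injective hw) f
  refine ⟨AffGroup.transHom hw θ.toMonoidHom, AffGroup.transHom_mulEquiv_injective hw θ,
    fun x => ?_⟩
  obtain ⟨g, hg⟩ := (D.mulEquiv hw).surjective ⟨x, 0⟩
  have h1 := congrArg AffGroup.trans (ha g)
  have h2 := congrArg AffGroup.trans (hb g)
  have h3 := AffGroup.hom_mk_zero hw θ.toMonoidHom
  simp only [MulEquiv.toMonoidHom_eq_coe, MonoidHom.coe_coe] at h3 ⊢
  simp only [braceLeft_apply, braceRight_apply, hg, mul_zero, h3, hD, hD'] at h1 h2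
  rw [← h2, ← h1]

end PairDatum

/-! ### Every pair has a normal form -/

/-- After a translation by `t`, the pair `a, b` is given by additive maps `α, β` on the Sylow
`p`-subgroup of its domain, which is parametrized by `P`, and maps `m` to `(0, j + 1)` and
`(0, j)`. -/
structure IsNormalForm {q : ℕ} {K : Type u} [Field K] {w : AddChar (ZMod q) K} {B : Type u}
    [SkewBrace B] (a b : B →* AffGroup w) (j : ZMod q) (t : K) (m : B) (P : K → B)
    (α β : K →+ K) : Prop where
  left_apply : ∀ x, a (P x) = ⟨α x, 0⟩
  right_apply : ∀ x, b (P x) = ⟨β x, 0⟩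
  sub_eq : ∀ x, α x - β x = x
  left_rot : MulAut.conj ⟨-t, 0⟩ (a m) = ⟨0, j + 1⟩
  right_rot : MulAut.conj ⟨-t, 0⟩ (b m) = ⟨0, j⟩
  exists_conj : ∀ x, ∃ y, α y = w (j + 1) * α x ∧ β y = w j * β x

section normalForm

variable {p q : ℕ} [Fact p.Prime] [Fact q.Prime] {K : Type u} [Field K] [Algebra (ZMod p) K]
  {w : AddChar (ZMod q) K} {B : Type u} [SkewBrace B] {a b : B →* AffGroup w}

theorem SkewBrace.IsRealizedBy.card_eq (h : IsRealizedBy a b) (hw : IsNormOneChar p w) :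
    Nat.card B = p ^ 2 * q := by
  rw [Nat.card_congr (Equiv.ofBijective _ h.bijective), AffGroup.card_of_isNormOneChar hw]

/-- If the two rotation parts of an element agree, they vanish: the elements with this property
form a subgroup of order `p²`. -/
theorem SkewBrace.IsRealizedBy.rot_eq_zero (h : IsRealizedBy a b) (hw : IsNormOneChar p w) {x : B}
    (hx : (a x).rot = (b x).rot) : (b x).rot = 0 := by
  let ρ : B →* Multiplicative (ZMod q) := (AffGroup.rotHom w).comp a / (AffGroup.rotHom w).comp b
  have hρ : ∀ y, ρ y = .ofAdd (a y * (b y)⁻¹).rot := fun y => by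
    simp only [AffGroup.rot_mul, AffGroup.rot_inv, ← sub_eq_add_neg]
    rfl
  have hsurj : Function.Surjective ρ := by
    intro i
    obtain ⟨y, hy⟩ := h.bijective.2 ⟨0, i.toAdd⟩
    simp only at hy
    exact ⟨y, by rw [hρ, hy]; rfl⟩
  have hker : Nat.card ρ.ker = p ^ 2 := by
    have h1 := ρ.ker.card_mul_index
    rw [Subgroup.index_ker, MonoidHom.range_eq_top.mpr hsurj, Subgroup.card_top, h.card_eq hw] at h1
    have h2 : Nat.card (Multiplicative (ZMod q)) = q := Nat.card_zmod q
    rw [h2] at h1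
    exact Nat.eq_of_mul_eq_mul_right (Fact.out : q.Prime).pos h1
  have hmem : x ∈ ρ.ker := by
    rw [MonoidHom.mem_ker, hρ]
    simp [hx]
  have hpow : x ^ p ^ 2 = 1 := by
    have h1 := pow_card_eq_one' (x := (⟨x, hmem⟩ : ρ.ker))
    rw [hker] at h1
    exact congrArg Subtype.val h1
  have h2 := congrArg (fun y => (b y).rot) hpow
  simp only [map_pow, AffGroup.rot_pow, map_one, AffGroup.rot_one] at h2
  refine (mul_eq_zero.mp h2).resolve_left ?_
  rw [Nat.cast_pow]
  exact pow_ne_zero 2 (AffGroup.natCast_p_ne_zero hw)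

theorem SkewBrace.IsRealizedBy.exists_isNormalForm (h : IsRealizedBy a b)
    (hw : IsNormOneChar p w) : ∃ j t m P α β, IsNormalForm a b j t m P α β := by
  obtain ⟨P, hP⟩ : ∃ P : K → B, ∀ x, a (P x) * (b (P x))⁻¹ = ⟨x, 0⟩ :=
    ⟨fun x => (h.bijective.2 ⟨x, 0⟩).choose, fun x => (h.bijective.2 ⟨x, 0⟩).choose_spec⟩
  obtain ⟨m₀, hm₀⟩ := h.bijective.2 ⟨0, 1⟩
  simp only at hm₀
  have hrot : ∀ x, (a (P x)).rot = 0 ∧ (b (P x)).rot = 0 := by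
    intro x
    have h1 := congrArg AffGroup.rot (hP x)
    simp only [AffGroup.rot_mul, AffGroup.rot_inv] at h1
    have h2 : (a (P x)).rot = (b (P x)).rot := by linear_combination h1
    have h3 := h.rot_eq_zero hw h2
    exact ⟨h2.trans h3, h3⟩
  have ha : ∀ x, a (P x) = ⟨(a (P x)).trans, 0⟩ := fun x => AffGroup.ext rfl (hrot x).1
  have hb : ∀ x, b (P x) = ⟨(b (P x)).trans, 0⟩ := fun x => AffGroup.ext rfl (hrot x).2
  have hsub : ∀ x, (a (P x)).trans - (b (P x)).trans = x := by
    intro x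
    have h1 := hP x
    rw [mul_inv_eq_iff_eq_mul, ha, hb] at h1
    have h2 := congrArg AffGroup.trans h1
    simp at h2
    linear_combination h2
  have hadd : ∀ x y, P (x + y) = P x * P y := by
    intro x y
    apply h.bijective.1
    simp only [map_mul]
    rw [hP, eq_mul_inv_iff_mul_eq, ha x, ha y, hb x, hb y]
    ext
    · simp
      linear_combination - hsub x - hsub y
    · simp
  let α : K →+ K := AddMonoidHom.mk' (fun x => (a (P x)).trans) (fun x y => by
    rw [hadd, map_mul, AffGroup.trans_mul, (hrot x).1]; simp)
  let β : K →+ K := AddMonoidHom.mk' (fun x => (b (P x)).trans) (fun x y => by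
    rw [hadd, map_mul, AffGroup.trans_mul, (hrot x).2]; simp)
  -- since `p² ≡ 1` modulo `q`, the power `m₀ ^ p²` has the same image in `ℤ_q` as `m₀`
  set m₁ := m₀ ^ p ^ 2 with hm₁
  have hm₁q : m₁ ^ q = 1 := by rw [hm₁, ← pow_mul, ← h.card_eq hw, pow_card_eq_one']
  set j := (b m₁).rot with hj
  have hj1 : (a m₁).rot = j + 1 := by
    have h1 := congrArg AffGroup.rot hm₀
    simp only [AffGroup.rot_mul, AffGroup.rot_inv] at h1
    rw [hj, hm₁, map_pow, map_pow, AffGroup.rot_pow, AffGroup.rot_pow, Nat.cast_pow, hw.cast_eq]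
    linear_combination h1
  obtain ⟨t₁, ht₁⟩ := AffGroup.exists_fixed hw (a m₁) (by rw [← map_pow, hm₁q, map_one])
  obtain ⟨t₂, ht₂⟩ := AffGroup.exists_fixed hw (b m₁) (by rw [← map_pow, hm₁q, map_one])
  -- conjugation by `P y` moves the fixed points of `a m₁` and `b m₁` by `α y` and `β y`
  set y := t₂ - t₁ with hy
  have ht : t₁ + α y = t₂ + β y := by
    have h1 : α y - β y = y := hsub y
    linear_combination h1 + hy
  set m := P y * m₁ * (P y)⁻¹ with hm
  have ham : a m = ⟨(1 - w (j + 1)) * (t₁ + α y), j + 1⟩ := by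
    rw [hm, map_mul, map_mul, map_inv, ha, AffGroup.conj_mk_zero, ht₁, hj1]
    ext
    · change _ + _ * α y = _
      ring
    · rfl
  have hbm : b m = ⟨(1 - w j) * (t₁ + α y), j⟩ := by
    rw [ht, hm, map_mul, map_mul, map_inv, hb, AffGroup.conj_mk_zero, ht₂, ← hj]
    ext
    · change _ + _ * β y = _
      ring
    · rfl
  refine ⟨j, t₁ + α y, m, P, α, β, ha, hb, hsub, ?_, ?_, fun x => ?_⟩
  · rw [MulAut.conj_apply, ham, AffGroup.conj_mk_zero_of_fixed _ _ rfl]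
  · rw [MulAut.conj_apply, hbm, AffGroup.conj_mk_zero_of_fixed _ _ rfl]
  · have hax : a (m * P x * m⁻¹) = ⟨w (j + 1) * α x, 0⟩ := by
      rw [map_mul, map_mul, map_inv, mul_inv_eq_iff_eq_mul, ha, ham]
      ext
      · simp [α]; ring
      · simp
    have hbx : b (m * P x * m⁻¹) = ⟨w j * β x, 0⟩ := by
      rw [map_mul, map_mul, map_inv, mul_inv_eq_iff_eq_mul, hb, hbm]
      ext
      · simp [β]; ring
      · simp
    have hy : P (w (j + 1) * α x - w j * β x) = m * P x * m⁻¹ := by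
      apply h.bijective.1
      simp only
      rw [hP, eq_mul_inv_iff_mul_eq, hax, hbx]
      ext <;> simp
    refine ⟨w (j + 1) * α x - w j * β x, ?_, ?_⟩
    · change (a (P _)).trans = _
      rw [hy, hax]
    · change (b (P _)).trans = _
      rw [hy, hbx]

/-- The subgroups `{(α x, β x)}` of `K × K` that occur in a normal form are `K × 0`, `0 × K`, and,
if `w j` and `w (j + 1)` are conjugate over the prime field, the graphs of semilinear maps. -/
theorem IsNormOneChar.trichotomy (hw : IsNormOneChar p w) {j : ZMod q} {α β : K →+ K}
    (hsub : ∀ x, α x - β x = x)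
    (hconj : ∀ x, ∃ y, α y = w (j + 1) * α x ∧ β y = w j * β x) :
    β = 0 ∨ α = 0 ∨ 2 * j + 1 = 0 ∧ Function.Surjective β ∧
      ∃ c : K, c ≠ 0 ∧ c ^ (p + 1) ≠ 1 ∧ ∀ x, α x = c * β x ^ p := by
  have := hw.finite
  by_cases hj : j = 0
  · -- `w j = 1`
    have hβ : β = 0 ∨ Function.Injective β := by
      refine hw.eq_zero_or_injective (p := p) (i := 1) one_ne_zero fun x hx => ?_
      obtain ⟨y, h1, h2⟩ := hconj x
      rw [hx, mul_zero] at h2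
      have h3 : y = w 1 * x := by
        have h4 := hsub x
        have h5 := hsub y
        rw [hx, sub_zero] at h4
        rw [h2, sub_zero, h1, h4, hj, zero_add] at h5
        exact h5.symm
      rwa [← h3]
    refine hβ.imp_right fun hβ => Or.inl ?_
    ext x
    obtain ⟨y, h1, h2⟩ := hconj x
    rw [hj, AddChar.map_zero_eq_one, one_mul] at h2
    rw [hβ h2, hj, zero_add] at h1
    have h3 : (1 - w 1) * α x = 0 := by linear_combination h1
    exact (mul_eq_zero.mp h3).resolve_left (hw.one_sub_ne_zero one_ne_zero)
  have hα : α = 0 ∨ Function.Injective α := by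
    refine hw.eq_zero_or_injective (p := p) hj fun x hx => ?_
    obtain ⟨y, h1, h2⟩ := hconj x
    rw [hx, mul_zero] at h1
    have h3 : y = w j * x := by
      have h4 := hsub x
      have h5 := hsub y
      rw [hx, zero_sub] at h4
      rw [h1, zero_sub, h2] at h5
      rw [← h5]
      linear_combination (w j) * h4
    rwa [← h3]
  rcases hα with hα | hα
  · exact Or.inr (Or.inl hα)
  by_cases hj1 : j + 1 = 0
  · left
    ext x
    obtain ⟨y, h1, h2⟩ := hconj x
    rw [hj1, AddChar.map_zero_eq_one, one_mul] at h1
    rw [hα h1] at h2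
    have h3 : (1 - w j) * β x = 0 := by linear_combination h2
    exact (mul_eq_zero.mp h3).resolve_left (hw.one_sub_ne_zero hj)
  have hβ : β = 0 ∨ Function.Injective β := by
    refine hw.eq_zero_or_injective (p := p) hj1 fun x hx => ?_
    obtain ⟨y, h1, h2⟩ := hconj x
    rw [hx, mul_zero] at h2
    have h3 : y = w (j + 1) * x := by
      have h4 := hsub x
      have h5 := hsub y
      rw [hx, sub_zero] at h4
      rw [h2, sub_zero, h1, h4] at h5
      exact h5.symm
    rwa [← h3]
  refine hβ.imp_right fun hβ => Or.inr ?_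
  let e : K ≃+ K := AddEquiv.ofBijective β (Finite.injective_iff_bijective.mp hβ)
  let T : K →+ K := α.comp e.symm.toAddMonoidHom
  have hTβ : ∀ x, T (β x) = α x := fun x => congrArg α (e.symm_apply_apply x)
  have hTmul : ∀ z, T (w j * z) = w (j + 1) * T z := by
    intro z
    obtain ⟨x, rfl⟩ := e.surjective z
    obtain ⟨y, h1, h2⟩ := hconj x
    change T (w j * β x) = w (j + 1) * T (β x)
    rw [← h2, hTβ, hTβ, h1]
  have hT0 : T ≠ 0 := by
    intro h0
    have h1 := hTβ 1
    rw [h0, AddMonoidHom.zero_apply] at h1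
    exact one_ne_zero (hα (by rw [← h1, map_zero]))
  rcases hw.semilinear hj hTmul hT0 with ⟨h1, -⟩ | ⟨h1, hT⟩
  · exact absurd (by linear_combination h1 : (1 : ZMod q) = 0) one_ne_zero
  refine ⟨by linear_combination h1, e.surjective, T 1, ?_, ?_, fun x => ?_⟩
  · intro h0
    apply hT0
    ext x
    rw [hT, h0, zero_mul, AddMonoidHom.zero_apply]
  · intro h0
    obtain ⟨u, hu0, hu⟩ := hw.exists_mul_pow_eq h0
    obtain ⟨x, rfl⟩ := e.surjective u
    change T 1 * β x ^ p = β x at hu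
    rw [← hT, hTβ] at hu
    have h2 := hsub x
    rw [hu, sub_self] at h2
    exact hu0 (by rw [← h2, map_zero])
  · rw [← hT, hTβ]

/-- A skew brace in normal form is isomorphic to that of a datum which describes, up to scaling,
the same subgroup of the square of the affine group. -/
theorem IsNormalForm.nonempty_iso (hw : IsNormOneChar p w) (h : SkewBrace.IsRealizedBy a b)
    {j : ZMod q} {t : K} {m : B} {P : K → B} {α β : K →+ K} (hn : IsNormalForm a b j t m P α β)
    (D : PairDatum w) (hj : D.rot = j) (u : Kˣ) (τ : K → K) (hα : ∀ x, α (τ x) = u * D.left x)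
    (hβ : ∀ x, β (τ x) = u * D.right x) : Nonempty (D.brace hw ≃+* B) := by
  let θ : AffGroup w ≃* AffGroup w := (AffGroup.scale w u).trans (MulAut.conj ⟨-t, 0⟩).symm
  refine (D.isRealizedBy hw).nonempty_ringEquiv h θ
    (fun g => P (τ (D.mulEquiv hw g).trans) * m ^ (D.mulEquiv hw g).rot.val) (fun g => ?_)
    (fun g => ?_)
  · change a _ = (MulAut.conj (⟨-t, 0⟩ : AffGroup w)).symm (AffGroup.scale w u (D.braceLeft hw g))
    rw [MulEquiv.eq_symm_apply, map_mul, map_mul, map_pow, map_pow, hn.left_rot, hn.left_apply,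
      hα, AffGroup.zero_mk_pow, PairDatum.braceLeft_apply, hj, MulAut.conj_apply,
      AffGroup.conj_mk_zero]
    ext
    · simp
    · simp [mul_comm]
  · change b _ = (MulAut.conj (⟨-t, 0⟩ : AffGroup w)).symm (AffGroup.scale w u (D.braceRight hw g))
    rw [MulEquiv.eq_symm_apply, map_mul, map_mul, map_pow, map_pow, hn.right_rot, hn.right_apply,
      hβ, AffGroup.zero_mk_pow, PairDatum.braceRight_apply, hj, MulAut.conj_apply,
      AffGroup.conj_mk_zero]
    ext
    · simp
    · simp [mul_comm]

end normalForm

/-! ### The isomorphism classes -/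

namespace PairDatum

variable {p q : ℕ} [Fact p.Prime] [Fact q.Prime] {K : Type u} [Field K]
  {w : AddChar (ZMod q) K}

/-- The pair `(x, i) ↦ (x, (j + 1) * i)`, `(x, i) ↦ (0, j * i)`. -/
def projLeft (w : AddChar (ZMod q) K) (j : ZMod q) : PairDatum w where
  rot := j
  act := j + 1
  left := AddMonoidHom.id K
  right := 0
  left_mul _ _ := rfl
  right_mul _ _ := by simp
  eq_zero i x h := by simpa using h

/-- The pair `(x, i) ↦ (0, (j + 1) * i)`, `(x, i) ↦ (x, j * i)`. -/
def projRight (w : AddChar (ZMod q) K) (j : ZMod q) : PairDatum w where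
  rot := j
  act := j
  left := 0
  right := AddMonoidHom.id K
  left_mul _ _ := by simp
  right_mul _ _ := rfl
  eq_zero i x h := by
    have h1 : w i * x = 0 := h.symm
    exact (mul_eq_zero.mp h1).resolve_left (IsNormOneChar.apply_ne_zero w i)

variable [Algebra (ZMod p) K]

/-- The pair `(x, i) ↦ (c * x ^ p, (j + 1) * i)`, `(x, i) ↦ (x, j * i)` for `j = -1/2`. -/
def frobGraph (hw : IsNormOneChar p w) (c : K) (hc : c ^ (p + 1) ≠ 1) : PairDatum w where
  rot := -2⁻¹
  act := -2⁻¹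
  left := AddMonoidHom.mk' (fun x => c * x ^ p) (fun x y => by
    have := IsNormOneChar.charP p K
    rw [add_pow_char, mul_add])
  right := AddMonoidHom.id K
  left_mul i x := by
    have h2 := hw.two_ne_zero
    have h : (-2⁻¹ + 1) * i = -(-2⁻¹ * i) := by field_simp; ring
    simp only [AddMonoidHom.mk'_apply]
    rw [mul_pow, hw.apply_pow, h]
    ring
  right_mul _ _ := rfl
  eq_zero i x h := by
    have h1 : c * x ^ p = w i * x := h
    by_contra hx
    -- both sides have to have the same norm
    have h2 : c ^ (p + 1) * x ^ (p + 1) = 1 * x ^ (p + 1) := by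
      calc c ^ (p + 1) * x ^ (p + 1) = c ^ (p + 1) * (x ^ p ^ 2 * x ^ p) := by
            rw [hw.pow_sq, pow_succ' x]
        _ = (c * x ^ p) ^ p * (c * x ^ p) := by ring
        _ = w (-i) * w i * (x ^ p * x) := by rw [h1, mul_pow, hw.apply_pow]; ring
        _ = 1 * x ^ (p + 1) := by
            rw [← AddChar.map_add_eq_mul, neg_add_cancel, AddChar.map_zero_eq_one, pow_succ]
    exact hc (mul_right_cancel₀ (pow_ne_zero _ hx) h2)

end PairDatum

/-- The isomorphism classes of skew braces: a first family with one member for each `j` in `ℤ_q`,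
a second one of the same kind, and a third one, indexed by the norms other than `0` and `1`. -/
abbrev BraceIndex (p q : ℕ) : Type :=
  ZMod q ⊕ ZMod q ⊕ {n : ZMod p // n ≠ 0 ∧ n ≠ 1}

namespace BraceIndex

variable {p q : ℕ} [Fact p.Prime] [Fact q.Prime] {K : Type u} [Field K] [Algebra (ZMod p) K]
  {w : AddChar (ZMod q) K}

theorem exists_norm_eq (hw : IsNormOneChar p w) (n : ZMod p) :
    ∃ c : K, c ^ (p + 1) = algebraMap (ZMod p) K n := by
  have := hw.finite
  obtain ⟨c, hc⟩ := FiniteField.norm_surjective (ZMod p) K n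
  exact ⟨c, by rw [← hw.algebraMap_norm, hc]⟩

/-- An element of norm `n`. -/
noncomputable def normSection (hw : IsNormOneChar p w) (n : ZMod p) : K :=
  (exists_norm_eq hw n).choose

theorem normSection_pow (hw : IsNormOneChar p w) (n : ZMod p) :
    normSection hw n ^ (p + 1) = algebraMap (ZMod p) K n :=
  (exists_norm_eq hw n).choose_spec

theorem normSection_pow_ne_one (hw : IsNormOneChar p w) {n : ZMod p} (hn : n ≠ 1) :
    normSection hw n ^ (p + 1) ≠ 1 := by
  rw [normSection_pow, ← map_one (algebraMap (ZMod p) K)]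
  exact fun h => hn ((algebraMap (ZMod p) K).injective h)

/-- The pair of homomorphisms that belongs to an index. -/
noncomputable def datum (hw : IsNormOneChar p w) : BraceIndex p q → PairDatum w
  | .inl j => .projLeft w j
  | .inr (.inl j) => .projRight w j
  | .inr (.inr n) => .frobGraph hw _ (normSection_pow_ne_one hw n.2.2)

/-- The skew brace that belongs to an index. -/
noncomputable def brace (hw : IsNormOneChar p w) (i : BraceIndex p q) : BundledSkewBrace.{u} :=
  (datum hw i).brace hw

/-- Every skew brace on the affine group is isomorphic to that of some index. -/
theorem exists_iso (hw : IsNormOneChar p w) {B : Type u} [SkewBrace B]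
    (e : B ≃+ Additive (AffGroup w)) : ∃ i, Nonempty (brace hw i ≃+* B) := by
  obtain ⟨a, b, h⟩ := SkewBrace.exists_isRealizedBy hw e
  obtain ⟨j, t, m, P, α, β, hn⟩ := h.exists_isNormalForm hw
  rcases hw.trichotomy hn.sub_eq hn.exists_conj with h0 | h0 | ⟨hj, hβ, c, hc0, hc1, hα⟩
  · refine ⟨.inl j, hn.nonempty_iso hw h _ rfl 1 id (fun x => ?_) (fun x => ?_)⟩
    · have h1 := hn.sub_eq x
      rw [h0, AddMonoidHom.zero_apply, sub_zero] at h1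
      simp [datum, PairDatum.projLeft, h1]
    · simp [datum, PairDatum.projLeft, h0]
  · refine ⟨.inr (.inl j), hn.nonempty_iso hw h _ rfl 1 (fun x => -x) (fun x => ?_) (fun x => ?_)⟩
    · simp [datum, PairDatum.projRight, h0]
    · have h1 := hn.sub_eq (-x)
      rw [h0, AddMonoidHom.zero_apply, zero_sub] at h1
      simp only [datum, PairDatum.projRight, AddMonoidHom.id_apply, Units.val_one, one_mul]
      linear_combination -h1
  · -- rescale so that `c` becomes the chosen element of the same norm
    set n := Algebra.norm (ZMod p) c with hndef
    have hn0 : n ≠ 0 := by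
      intro h0
      have h1 := hw.algebraMap_norm c
      rw [← hndef, h0, map_zero] at h1
      exact pow_ne_zero _ hc0 h1.symm
    have hn1 : n ≠ 1 := by
      intro h0
      have h1 := hw.algebraMap_norm c
      rw [← hndef, h0, map_one] at h1
      exact hc1 h1.symm
    set c' := normSection hw n with hc'
    have hc'n : c' ^ (p + 1) = c ^ (p + 1) := by
      rw [hc', normSection_pow, hndef, hw.algebraMap_norm]
    have hc'0 : c' ≠ 0 := by
      intro h0
      rw [h0, zero_pow (Nat.succ_ne_zero p)] at hc'n
      exact pow_ne_zero _ hc0 hc'n.symm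
    obtain ⟨u, hu0, hu⟩ := hw.exists_mul_pow_eq (c := c / c')
      (by rw [div_pow, hc'n, div_self (pow_ne_zero _ hc0)])
    have hu' : c * u ^ p = u * c' := by
      field_simp at hu
      linear_combination hu
    choose σ hσ using hβ
    have hjrot : (-2⁻¹ : ZMod q) = j := by
      have h2 := hw.two_ne_zero
      field_simp
      linear_combination -hj
    refine ⟨.inr (.inr ⟨n, hn0, hn1⟩), hn.nonempty_iso hw h _ hjrot (Units.mk0 u hu0)
      (fun x => σ (u * x)) (fun x => ?_) (fun x => ?_)⟩
    · rw [hα, hσ]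
      change c * (u * x) ^ p = u * (c' * x ^ p)
      linear_combination (x ^ p) * hu'
    · rw [hσ]
      rfl

theorem card_kernel (j : ZMod q) :
    Nat.card {i : ZMod q // j * i = 0} = if j = 0 then q else 1 := by
  split_ifs with hj
  · rw [Nat.card_congr (Equiv.subtypeUnivEquiv (fun i => by rw [hj, zero_mul])), Nat.card_zmod]
  · rw [Nat.card_eq_one_iff_unique]
    exact ⟨⟨fun a b => Subtype.ext (((mul_eq_zero.mp a.2).resolve_left hj).trans
      ((mul_eq_zero.mp b.2).resolve_left hj).symm)⟩, ⟨⟨0, mul_zero j⟩⟩⟩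

theorem cardKer_inl (hw : IsNormOneChar p w) (j : ZMod q) :
    (brace hw (.inl j)).cardKer = if j = 0 then p ^ 2 * q else p ^ 2 := by
  have h1 : Nat.card {x // (datum hw (.inl j)).right x = 0} = p ^ 2 := by
    rw [← hw.card_eq]
    exact Nat.card_congr (Equiv.subtypeUnivEquiv (fun _ => rfl))
  rw [brace, PairDatum.cardKer_brace, h1]
  change p ^ 2 * Nat.card {i : ZMod q // j * i = 0} = _
  rw [card_kernel]
  split_ifs <;> simp

theorem cardKer_inr_inl (hw : IsNormOneChar p w) (j : ZMod q) :
    (brace hw (.inr (.inl j))).cardKer = if j = 0 then q else 1 := by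
  have h1 : Nat.card {x // (datum hw (.inr (.inl j))).right x = 0} = 1 :=
    Nat.card_unique (α := {x : K // x = 0})
  rw [brace, PairDatum.cardKer_brace, h1, one_mul]
  exact card_kernel j

theorem cardKer_inr_inr (hw : IsNormOneChar p w) (n : {n : ZMod p // n ≠ 0 ∧ n ≠ 1}) :
    (brace hw (.inr (.inr n))).cardKer = 1 := by
  have h1 : Nat.card {x // (datum hw (.inr (.inr n))).right x = 0} = 1 :=
    Nat.card_unique (α := {x : K // x = 0})
  rw [brace, PairDatum.cardKer_brace, h1, one_mul]
  refine (card_kernel (-2⁻¹ : ZMod q)).trans ?_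
  rw [if_neg (neg_ne_zero.mpr (inv_ne_zero hw.two_ne_zero))]

end BraceIndex

namespace BundledSkewBrace

theorem cardKer_eq_of_iso {A B : BundledSkewBrace.{u}} (f : A ≃+* B) : A.cardKer = B.cardKer := by
  have hmem : ∀ x : A, x ∈ (SkewBrace.lam A).ker ↔ f x ∈ (SkewBrace.lam B).ker := by
    intro x
    have h : ∀ y, f ((SkewBrace.lam A x).toAdd y) = (SkewBrace.lam B (f x)).toAdd (f y) := by
      intro y; simp [SkewBrace.lam_apply]
    rw [MonoidHom.mem_ker, MonoidHom.mem_ker]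
    constructor
    · intro hx
      apply Multiplicative.toAdd.injective
      ext y
      obtain ⟨y, rfl⟩ := f.surjective y
      rw [← h, hx]
      rfl
    · intro hx
      apply Multiplicative.toAdd.injective
      ext y
      apply f.injective
      rw [h, hx]
      rfl
  exact Nat.card_congr (f.toEquiv.subtypeEquiv hmem)

end BundledSkewBrace

namespace BraceIndex

variable {p q : ℕ} [Fact p.Prime] [Fact q.Prime] {K : Type u} [Field K] [Algebra (ZMod p) K]
  {w : AddChar (ZMod q) K}

/-- The norm that belongs to an index of the second or third family, where it is `0` in the
second one. -/
def normIndex : ZMod q ⊕ {n : ZMod p // n ≠ 0 ∧ n ≠ 1} → ZMod p :=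
  Sum.elim (fun _ => 0) Subtype.val

theorem left_left (hw : IsNormOneChar p w) (i : ZMod q ⊕ {n : ZMod p // n ≠ 0 ∧ n ≠ 1}) (x : K) :
    (datum hw (.inr i)).left ((datum hw (.inr i)).left x) =
      algebraMap (ZMod p) K (normIndex i) * x := by
  rcases i with j | n
  · simp [datum, PairDatum.projRight, normIndex]
  · change _ * (_ * x ^ p) ^ p = _
    rw [mul_pow, ← pow_mul, ← sq, hw.pow_sq, ← mul_assoc, ← pow_succ', normSection_pow]
    rfl

/-- Skew braces of different indices are not isomorphic. They are told apart by `|ker λ|`, by `j`,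
which relates the actions on the quotient `ℤ_q`, and by the norm `n`, as `c ^ (p + 1)` is the square
of `x ↦ c * x ^ p`. -/
theorem eq_of_iso (hw : IsNormOneChar p w) {i i' : BraceIndex p q}
    (f : brace hw i ≃+* brace hw i') : i = i' := by
  have hq := (Fact.out : q.Prime).two_le
  have hpq : q < p ^ 2 := hw.lt.trans_le (Nat.le_self_pow two_ne_zero p)
  have hcard := BundledSkewBrace.cardKer_eq_of_iso f
  have hrot := PairDatum.rot_eq_of_iso hw f
  have hleft : ∀ (j : ZMod q), q < (brace hw (.inl j)).cardKer := by
    intro j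
    rw [cardKer_inl]
    split_ifs
    · nlinarith
    · exact hpq
  have hright : ∀ k, (brace hw (.inr k)).cardKer ≤ q := by
    rintro (j | n)
    · rw [cardKer_inr_inl]
      split_ifs <;> omega
    · rw [cardKer_inr_inr]
      omega
  rcases i with j | k <;> rcases i' with j' | k'
  · exact congrArg Sum.inl hrot
  · have := hleft j; have := hright k'; omega
  · have := hleft j'; have := hright k; omega
  have hid : ∀ (k : ZMod q ⊕ {n : ZMod p // n ≠ 0 ∧ n ≠ 1}) x,
      (datum hw (.inr k)).right x = x := by rintro (j | n) x <;> rfl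
  obtain ⟨T, hT, hTl⟩ := PairDatum.exists_intertwining hw (hid k) (hid k') f
  have hnorm : normIndex k = normIndex k' := by
    have h1 := congrArg (datum hw (.inr k')).left (hTl 1)
    rw [left_left, hTl, left_left, IsNormOneChar.map_algebraMap_mul] at h1
    have h2 : T 1 ≠ 0 := fun h => one_ne_zero (hT (h.trans (map_zero T).symm))
    exact (algebraMap (ZMod p) K).injective (mul_right_cancel₀ h2 h1).symm
  rcases k with j | n <;> rcases k' with j' | n'
  · exact congrArg (fun j => Sum.inr (Sum.inl j)) hrot
  · exact absurd hnorm.symm n'.2.1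
  · exact absurd hnorm n.2.1
  · exact congrArg (fun n => Sum.inr (Sum.inr n)) (Subtype.ext hnorm)

end BraceIndex

/-! ### Non-abelian groups of order `p² q` -/

section uniqueness

variable {p q : ℕ} [Fact p.Prime] [Fact q.Prime] {K : Type u} [Field K] [Algebra (ZMod p) K]
  {w : AddChar (ZMod q) K}

theorem IsNormOneChar.finrank_eq (hw : IsNormOneChar p w) : Module.finrank (ZMod p) K = 2 := by
  have := hw.finite
  have h := Module.natCard_eq_pow_finrank (K := ZMod p) (V := K)
  rw [hw.card_eq, Nat.card_zmod] at h
  exact (Nat.pow_right_injective (Fact.out : p.Prime).two_le h).symm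

theorem IsNormOneChar.nonempty_addEquiv (hw : IsNormOneChar p w) {A : Type v} [AddCommGroup A]
    [Module (ZMod p) A] (hA : Nat.card A = p ^ 2) : Nonempty (A ≃+ K) := by
  have := hw.finite
  have : Finite A := Nat.finite_of_card_ne_zero
    (by rw [hA]; exact pow_ne_zero 2 (Fact.out : p.Prime).ne_zero)
  have : Module.Finite (ZMod p) A := Module.Finite.of_finite
  have h := Module.natCard_eq_pow_finrank (K := ZMod p) (V := A)
  rw [hA, Nat.card_zmod] at h
  have h2 := Nat.pow_right_injective (Fact.out : p.Prime).two_le h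
  exact ⟨(LinearEquiv.ofFinrankEq A K (h2.symm.trans hw.finrank_eq.symm)).toAddEquiv⟩

/-- The isotypic projection `∑ i, w (-(k * i)) * T ^ i`. -/
noncomputable def averageHom (w : AddChar (ZMod q) K) (T : AddMonoid.End K) (k : ZMod q) :
    K →+ K :=
  ∑ i : ZMod q, (AddMonoidHom.mulLeft (w (-(k * i)))).comp (T ^ i.val)

theorem averageHom_apply (w : AddChar (ZMod q) K) (T : AddMonoid.End K) (k : ZMod q) (x : K) :
    averageHom w T k x = ∑ i : ZMod q, w (-(k * i)) * (T ^ i.val) x := by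
  rw [averageHom, AddMonoidHom.finsetSum_apply]
  rfl

theorem averageHom_map (w : AddChar (ZMod q) K) {T : AddMonoid.End K} (hT : T ^ q = 1)
    (k : ZMod q) (x : K) : averageHom w T k (T x) = w k * averageHom w T k x := by
  have hsucc : ∀ i : ZMod q, (T ^ i.val) (T x) = (T ^ (i + 1).val) x := by
    intro i
    have h1 : T ^ (i + 1).val = T ^ i.val * T := by
      have h2 : ((i.val + 1 : ℕ) : ZMod q) = i + 1 := by push_cast; rw [ZMod.natCast_zmod_val]
      rw [← h2, ZMod.val_natCast, ← pow_succ]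
      exact (pow_eq_pow_mod _ hT).symm
    rw [h1]
    rfl
  rw [averageHom_apply, averageHom_apply, Finset.mul_sum,
    ← Equiv.sum_comp (Equiv.addRight (1 : ZMod q)) (fun i => w k * (w _ * _))]
  refine Finset.sum_congr rfl fun i _ => ?_
  rw [Equiv.coe_addRight, ← mul_assoc, ← AddChar.map_add_eq_mul, hsucc i]
  congr 2
  ring

theorem sum_averageHom (hw : IsNormOneChar p w) (T : AddMonoid.End K) (x : K) :
    ∑ k : ZMod q, averageHom w T k x = q * x := by
  have hprim : w.IsPrimitive := by
    refine AddChar.IsPrimitive.of_ne_one fun h => hw.apply_ne_one (one_ne_zero (α := ZMod q)) ?_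
    rw [h, AddChar.one_apply]
  simp only [averageHom_apply]
  rw [Finset.sum_comm]
  have h : ∀ i : ZMod q, ∑ k : ZMod q, w (-(k * i)) * (T ^ i.val) x =
      if i = 0 then q * x else 0 := by
    intro i
    have h1 := AddChar.sum_mulShift (-i) hprim
    simp only [mul_neg] at h1
    rw [← Finset.sum_mul, h1]
    by_cases hi : i = 0
    · simp [hi, ZMod.card]
    · simp [hi]
  simp only [h, Finset.sum_ite_eq', Finset.mem_univ, if_true]

/-- A non-trivial automorphism of order `q` of the additive group of the field is conjugate to the
multiplication by some `w k`. -/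
theorem exists_addEquiv_intertwining (hw : IsNormOneChar p w) {T : AddMonoid.End K}
    (hT : T ^ q = 1) (hT1 : T ≠ 1) :
    ∃ k : ZMod q, k ≠ 0 ∧ ∃ E : K ≃+ K, ∀ x, E (T x) = w k * E x := by
  have := hw.finite
  obtain ⟨k, hk, hE⟩ : ∃ k : ZMod q, k ≠ 0 ∧ averageHom w T k ≠ 0 := by
    by_contra! h
    apply hT1
    ext x
    have h1 : ∀ y, (q : K) * y = averageHom w T 0 y := by
      intro y
      rw [← sum_averageHom hw T y]
      refine Finset.sum_eq_single_of_mem 0 (Finset.mem_univ _) fun k _ hk => ?_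
      rw [h k hk, AddMonoidHom.zero_apply]
    have h2 := averageHom_map w hT 0 x
    rw [AddChar.map_zero_eq_one, one_mul, ← h1, ← h1] at h2
    exact mul_left_cancel₀ hw.natCast_q_ne_zero h2
  refine ⟨k, hk, ?_⟩
  -- the image of the projection is stable under `w k`
  let S := LinearMap.range ((averageHom w T k).toZModLinearMap p)
  have hS : ∀ x, averageHom w T k x ∈ S := fun x => ⟨x, rfl⟩
  have hdich := hw.eq_zero_or_injective (p := p) (T := S.mkQ.toAddMonoidHom) hk (fun x hx => by
    have hx' : S.mkQ x = 0 := hx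
    rw [Submodule.mkQ_apply, Submodule.Quotient.mk_eq_zero] at hx'
    obtain ⟨y, rfl⟩ := hx'
    change S.mkQ _ = 0
    rw [Submodule.mkQ_apply, Submodule.Quotient.mk_eq_zero]
    exact ⟨T y, averageHom_map w hT k y⟩)
  rcases hdich with h0 | hinj
  · have hsurj : Function.Surjective (averageHom w T k) := by
      intro y
      have h1 : S.mkQ y = 0 := DFunLike.congr_fun h0 y
      rw [Submodule.mkQ_apply, Submodule.Quotient.mk_eq_zero] at h1
      exact h1
    exact ⟨AddEquiv.ofBijective (averageHom w T k) (Finite.surjective_iff_bijective.mp hsurj),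
      averageHom_map w hT k⟩
  · refine absurd (AddMonoidHom.ext fun x => hinj ?_) hE
    change S.mkQ _ = S.mkQ 0
    rw [map_zero, Submodule.mkQ_apply, Submodule.Quotient.mk_eq_zero]
    exact hS x

variable {G : Type v} [Group G]

theorem exists_normal_of_card_eq (hw : IsNormOneChar p w) (hG : Nat.card G = p ^ 2 * q) :
    ∃ N : Subgroup G, N.Normal ∧ Nat.card N = p ^ 2 := by
  have hp := (Fact.out : p.Prime)
  have hq := (Fact.out : q.Prime)
  have hlt := hw.lt
  have : Finite G := Nat.finite_of_card_ne_zero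
    (by rw [hG]; exact mul_ne_zero (pow_ne_zero 2 hp.ne_zero) hq.ne_zero)
  let P : Sylow p G := default
  have hP : Nat.card P = p ^ 2 := by
    rw [P.card_eq_multiplicity, hG, Nat.factorization_mul (pow_ne_zero 2 hp.ne_zero) hq.ne_zero,
      hp.factorization_pow, hq.factorization]
    simp [hlt.ne]
  refine ⟨P, ?_, hP⟩
  have hidx : (P : Subgroup G).index = q := by
    have h := (P : Subgroup G).card_mul_index
    rw [hP, hG] at h
    exact Nat.eq_of_mul_eq_mul_left (pow_pos hp.pos 2) h
  have h1 := P.card_dvd_index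
  rw [hidx, Nat.dvd_prime hq] at h1
  rcases h1 with h1 | h1
  · have := (Nat.card_eq_one_iff_unique.mp h1).1
    exact P.normal_of_subsingleton
  · have h2 := card_sylow_modEq_one p G
    rw [h1] at h2
    have h3 := Nat.ModEq.eq_of_lt_of_lt h2 hlt hp.one_lt
    exact absurd h3 hq.ne_one

theorem eq_top_of_le_of_mem (hw : IsNormOneChar p w) (hG : Nat.card G = p ^ 2 * q)
    {N H : Subgroup G} (hN : Nat.card N = p ^ 2) (hNH : N ≤ H) {h : G} (hh : orderOf h = q)
    (hH : h ∈ H) : H = ⊤ := by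
  have hp := (Fact.out : p.Prime)
  have hq := (Fact.out : q.Prime)
  have : Finite G := Nat.finite_of_card_ne_zero
    (by rw [hG]; exact mul_ne_zero (pow_ne_zero 2 hp.ne_zero) hq.ne_zero)
  have h1 : p ^ 2 ∣ Nat.card H := hN ▸ Subgroup.card_dvd_of_le hNH
  have h2 : q ∣ Nat.card H := hh ▸ H.orderOf_dvd_natCard hH
  have hcop : Nat.Coprime (p ^ 2) q := ((Nat.coprime_primes hp hq).mpr hw.lt.ne').pow_left 2
  have h3 := hcop.mul_dvd_of_dvd_of_dvd h1 h2
  rw [← hG] at h3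
  exact H.eq_top_of_card_eq (Nat.dvd_antisymm H.card_subgroup_dvd_card h3)

/-- The group of order `p² q` is abelian if an element of order `q` centralizes the normal subgroup
of order `p²`. -/
theorem mul_comm_of_conjNormal_eq_one (hw : IsNormOneChar p w) (hG : Nat.card G = p ^ 2 * q)
    {N : Subgroup G} [N.Normal] (hN : Nat.card N = p ^ 2) {h : G} (hh : orderOf h = q)
    (hconj : MulAut.conjNormal (H := N) h = 1) (a b : G) : a * b = b * a := by
  have hNcomm := (IsPGroup.isMulCommutative_of_card_eq_prime_sq hN).is_comm.comm
  have hcomm : ∀ n ∈ N, h * n = n * h := by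
    intro n hn
    have h1 := congrArg Subtype.val (DFunLike.congr_fun hconj ⟨n, hn⟩)
    rw [MulAut.conjNormal_apply, MulAut.one_apply, mul_inv_eq_iff_eq_mul] at h1
    exact h1
  have h1 : Subgroup.centralizer {h} = ⊤ := by
    refine eq_top_of_le_of_mem hw hG hN (fun n hn => ?_) hh ?_
    · rw [Subgroup.mem_centralizer_singleton_iff, hcomm n hn]
    · rw [Subgroup.mem_centralizer_singleton_iff]
  have h2 : Subgroup.center G = ⊤ := by
    refine eq_top_of_le_of_mem hw hG hN (fun n hn => ?_) hh ?_
    · rw [Subgroup.mem_center_iff]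
      intro g
      have h3 : Subgroup.centralizer {n} = ⊤ := by
        refine eq_top_of_le_of_mem hw hG hN (fun m hm => ?_) hh ?_
        · rw [Subgroup.mem_centralizer_singleton_iff]
          exact congrArg Subtype.val (hNcomm ⟨m, hm⟩ ⟨n, hn⟩)
        · rw [Subgroup.mem_centralizer_singleton_iff, hcomm n hn]
      exact Subgroup.mem_centralizer_singleton_iff.mp (h3 ▸ Subgroup.mem_top g)
    · rw [Subgroup.mem_center_iff]
      intro g
      exact Subgroup.mem_centralizer_singleton_iff.mp (h1 ▸ Subgroup.mem_top g)
  exact Subgroup.mem_center_iff.mp (h2 ▸ Subgroup.mem_top b) a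

/-- Every non-abelian group of order `p² q` is isomorphic to the affine group. -/
theorem nonempty_affGroup_mulEquiv (hw : IsNormOneChar p w) (hG : Nat.card G = p ^ 2 * q)
    (hnc : ¬ ∀ a b : G, a * b = b * a) : Nonempty (AffGroup w ≃* G) := by
  have hp := (Fact.out : p.Prime)
  have hq := (Fact.out : q.Prime)
  have : Finite G := Nat.finite_of_card_ne_zero
    (by rw [hG]; exact mul_ne_zero (pow_ne_zero 2 hp.ne_zero) hq.ne_zero)
  obtain ⟨N, hNn, hN⟩ := exists_normal_of_card_eq hw hG
  obtain ⟨h, hh⟩ := exists_prime_orderOf_dvd_card' q (hG ▸ Dvd.intro_left _ rfl : q ∣ Nat.card G)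
  have hhq : h ^ q = 1 := hh ▸ pow_orderOf_eq_one h
  have hconj : MulAut.conjNormal (H := N) h ≠ 1 := fun h1 =>
    hnc (mul_comm_of_conjNormal_eq_one hw hG hN hh h1)
  have hconjq : MulAut.conjNormal (H := N) h ^ q = 1 := by rw [← map_pow, hhq, map_one]
  -- a cyclic group of order `p²` has no automorphisms of order `q`
  have hcyc : ¬ IsCyclic N := by
    refine fun hcyc => hconj ?_
    have h1 := IsCyclic.card_mulAut N
    rw [hN, Nat.totient_prime_pow hp two_pos] at h1
    have h2 : MulAut.conjNormal (H := N) h ^ (p ^ (2 - 1) * (p - 1)) = 1 := by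
      rw [← h1, pow_card_eq_one']
    have hcop : Nat.Coprime q (p ^ (2 - 1) * (p - 1)) := by
      rw [hq.coprime_iff_not_dvd, hq.dvd_mul]
      rintro (h3 | h3)
      · exact hw.lt.ne ((Nat.prime_dvd_prime_iff_eq hq hp).mp (hq.dvd_of_dvd_pow h3))
      · rw [← ZMod.natCast_eq_zero_iff, Nat.cast_sub hp.one_lt.le, hw.cast_eq] at h3
        apply hw.two_ne_zero
        push_cast at h3
        linear_combination -h3
    have h3 := pow_gcd_eq_one.mpr ⟨hconjq, h2⟩
    rwa [hcop.gcd_eq_one, pow_one] at h3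
  have helem : ∀ x : N, x ^ p = 1 := fun x => by
    rw [← (not_isCyclic_iff_exponent_eq_prime hp hN).mp hcyc, Monoid.pow_exponent_eq_one]
  let _ : CommGroup N :=
    { (inferInstance : Group N) with
      mul_comm := (IsPGroup.isMulCommutative_of_card_eq_prime_sq hN).is_comm.comm }
  let _ : Module (ZMod p) (Additive N) :=
    AddCommGroup.zmodModule (fun x => congrArg Additive.ofMul (helem x.toMul))
  obtain ⟨ι⟩ := hw.nonempty_addEquiv (A := Additive N) hN
  let T : AddMonoid.End K := (ι.toAddMonoidHom.comp (MonoidHom.toAdditive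
    (MulAut.conjNormal (H := N) h).toMonoidHom)).comp ι.symm.toAddMonoidHom
  have hT : ∀ n : ℕ, ∀ x : N, (T ^ n) (ι (.ofMul x)) =
      ι (.ofMul (MulAut.conjNormal (H := N) (h ^ n) x)) := by
    intro n
    induction n with
    | zero => intro x; simp
    | succ n ih =>
      intro x
      rw [pow_succ', pow_succ', map_mul, MulAut.mul_apply]
      change T ((T ^ n) _) = _
      rw [ih]
      change ι (.ofMul (MulAut.conjNormal (H := N) h (ι.symm (ι (.ofMul _))).toMul)) = _
      rw [AddEquiv.symm_apply_apply]
      rfl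
  have hTq : T ^ q = 1 := by
    ext x
    obtain ⟨x, rfl⟩ := ι.surjective x
    have h1 := hT q x.toMul
    rw [hhq, map_one] at h1
    exact h1
  have hT1 : T ≠ 1 := by
    intro h0
    apply hconj
    ext1 x
    have h1 := hT 1 x
    rw [h0, pow_one, pow_one] at h1
    exact (congrArg Additive.toMul (ι.injective h1)).symm
  obtain ⟨k, hk, E, hE⟩ := exists_addEquiv_intertwining hw hTq hT1
  have hEpow : ∀ n : ℕ, ∀ x, E ((T ^ n) x) = w (n * k) * E x := by
    intro n
    induction n with
    | zero => intro x; simp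
    | succ n ih =>
      intro x
      rw [pow_succ']
      change E (T ((T ^ n) x)) = _
      rw [hE, ih, ← mul_assoc, ← AddChar.map_add_eq_mul]
      congr 2
      push_cast
      ring
  -- a power of `h` that acts as the multiplication by `w 1`
  set n := (k⁻¹).val with hn
  have hnk : (n : ZMod q) * k = 1 := by rw [hn, ZMod.natCast_zmod_val, inv_mul_cancel₀ hk]
  let e : Multiplicative K →* G :=
    N.subtype.comp (AddMonoidHom.toMultiplicativeLeft
      (ι.symm.toAddMonoidHom.comp E.symm.toAddMonoidHom))
  have he : ∀ x : N, e (.ofAdd (E (ι (.ofMul x)))) = x := by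
    intro x
    change ((ι.symm (E.symm (E (ι (.ofMul x))))).toMul : G) = x
    rw [AddEquiv.symm_apply_apply, AddEquiv.symm_apply_apply]
    rfl
  have hlift : ∀ x : K, h ^ n * e (.ofAdd x) * (h ^ n)⁻¹ = e (.ofAdd (w 1 * x)) := by
    intro x
    obtain ⟨x, rfl⟩ := E.surjective x
    obtain ⟨x, rfl⟩ := ι.surjective x
    have h1 := he (MulAut.conjNormal (H := N) (h ^ n) x.toMul)
    rw [← hT, hEpow, hnk, MulAut.conjNormal_apply] at h1
    refine Eq.trans ?_ h1.symm
    congr 2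
    exact he x.toMul
  have hnq : (h ^ n) ^ q = 1 := by rw [← pow_mul, mul_comm, pow_mul, hhq, one_pow]
  let f : AffGroup w →* G := AffGroup.lift e (h ^ n) hnq hlift
  have hfe : ∀ x, f ⟨x, 0⟩ = e (.ofAdd x) := by
    intro x
    change e (.ofAdd x) * (h ^ n) ^ (0 : ZMod q).val = _
    rw [ZMod.val_zero, pow_zero, mul_one]
  have hfh : f ⟨0, k⟩ = h := by
    change e (.ofAdd 0) * (h ^ n) ^ k.val = _
    rw [ofAdd_zero, map_one, one_mul, ← pow_mul]
    have h1 : ((n * k.val : ℕ) : ZMod q) = ((1 : ℕ) : ZMod q) := by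
      rw [Nat.cast_mul, ZMod.natCast_zmod_val k, hnk, Nat.cast_one]
    rw [ZMod.natCast_eq_natCast_iff] at h1
    have h2 : n * k.val ≡ 1 [MOD orderOf h] := by rwa [hh]
    rw [pow_eq_pow_iff_modEq.mpr h2, pow_one]
  have hrange : f.range = ⊤ := by
    refine eq_top_of_le_of_mem hw hG hN (fun x hx => ?_) hh ⟨_, hfh⟩
    exact ⟨⟨_, 0⟩, (hfe _).trans (he ⟨x, hx⟩)⟩
  have := AffGroup.finite hw w
  have hbij : Function.Bijective f :=
    (MonoidHom.range_eq_top.mp hrange).bijective_of_nat_card_le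
      (by rw [hG, AffGroup.card_of_isNormOneChar hw])
  exact ⟨MulEquiv.ofBijective f hbij⟩

theorem AffGroup.not_comm {w' : AddChar (ZMod q) K} (h : w' 1 ≠ 1) :
    ¬ ∀ a b : AffGroup w', a * b = b * a := by
  intro hc
  have h1 := congrArg AffGroup.trans (hc ⟨0, 1⟩ ⟨1, 0⟩)
  simp at h1
  exact h h1

end uniqueness

/-! ### Existence of the field and of the matrix -/

section existence

variable {p q : ℕ} [Fact p.Prime] [Fact q.Prime] {K : Type u} [Field K]

theorem exists_isNormOneChar (hK : Nat.card K = p ^ 2) (hp : p ≠ 2) (hq : q ≠ 2)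
    (hpq : (p : ZMod q) = -1) : ∃ w : AddChar (ZMod q) K, IsNormOneChar p w := by
  have : Finite K := Nat.finite_of_card_ne_zero
    (by rw [hK]; exact pow_ne_zero 2 (Fact.out : p.Prime).ne_zero)
  have hdvd : q ∣ Nat.card Kˣ := by
    rw [Nat.card_units, hK, ← ZMod.natCast_eq_zero_iff,
      Nat.cast_sub (Nat.one_le_pow _ _ (Fact.out : p.Prime).pos), Nat.cast_pow, hpq]
    simp
  obtain ⟨ζ, hζ⟩ := exists_prime_orderOf_dvd_card' q hdvd
  have hζq : (ζ : K) ^ q = 1 := by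
    rw [← Units.val_pow_eq_pow_val, ← hζ, pow_orderOf_eq_one, Units.val_one]
  refine ⟨AddChar.zmodChar q hζq, hK, fun i j hij => ?_, hp, hq, hpq⟩
  rw [AddChar.zmodChar_apply, AddChar.zmodChar_apply, ← Units.val_pow_eq_pow_val,
    ← Units.val_pow_eq_pow_val, Units.val_inj, pow_inj_mod, hζ, Nat.mod_eq_of_lt (ZMod.val_lt i),
    Nat.mod_eq_of_lt (ZMod.val_lt j)] at hij
  exact ZMod.val_injective q hij

variable [Algebra (ZMod p) K] {w : AddChar (ZMod q) K}

/-- The minimal polynomial of `w 1` over the prime field has the required properties. -/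
theorem IsNormOneChar.exists_irreducible (hw : IsNormOneChar p w) :
    ∃ ξ : ZMod p, Irreducible (X ^ 2 + C ξ * X + 1 : (ZMod p)[X]) ∧
      orderOf (companionF ξ) = q := by
  have := charP p K
  have hne : w 1 ≠ w (-1) := fun h => hw.neg_ne_self one_ne_zero (hw.injective h.symm)
  have hmul : w 1 * w (-1) = 1 := AffGroup.apply_mul_neg w 1
  obtain ⟨a, ha⟩ : ∃ a : ZMod p, w 1 + w (-1) = algebraMap (ZMod p) K a := by
    obtain ⟨a, b, hab⟩ := hw.exists_linComb one_ne_zero (w 1 + w (-1))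
    have h1 := congrArg (· ^ p) hab
    simp only [add_pow_char, mul_pow, algebraMap_pow, hw.apply_pow, neg_neg] at h1
    have h2 : algebraMap (ZMod p) K b = 0 := by
      have h3 : algebraMap (ZMod p) K b * (w 1 - w (-1)) = 0 := by linear_combination h1 - hab
      exact (mul_eq_zero.mp h3).resolve_right (sub_ne_zero.mpr hne)
    exact ⟨a, by rw [hab, h2, zero_mul, add_zero]⟩
  refine ⟨-a, ?_, ?_⟩
  · refine irreducible_of_degree_le_three_of_not_isRoot ?_ fun r hr => ?_
    · have : (X ^ 2 + C (-a) * X + 1 : (ZMod p)[X]).natDegree = 2 := by compute_degree!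
      rw [this]
      decide
    · have h1 : r ^ 2 + -a * r + 1 = 0 := by simpa [IsRoot] using hr
      have h2 := congrArg (algebraMap (ZMod p) K) h1
      rw [map_add, map_add, map_mul, map_neg, map_pow, map_one, map_zero, ← ha] at h2
      have h3 : (w 1 - algebraMap (ZMod p) K r) * (w (-1) - algebraMap (ZMod p) K r) = 0 := by
        linear_combination h2 + hmul
      rcases mul_eq_zero.mp h3 with h4 | h4
      · exact hw.apply_ne_algebraMap one_ne_zero r (sub_eq_zero.mp h4)
      · exact hw.apply_ne_algebraMap (neg_ne_zero.mpr one_ne_zero) r (sub_eq_zero.mp h4)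
  · -- the matrix describes the multiplication by `w 1` in the basis `1, w 1`
    let L : (Fin 2 → ZMod p) → K := fun v =>
      algebraMap (ZMod p) K (v 0) + algebraMap (ZMod p) K (v 1) * w 1
    have hL : Function.Injective L := by
      intro v v' h
      have h1 := hw.linComb_injective one_ne_zero (a₁ := (v 0, v 1)) (a₂ := (v' 0, v' 1)) h
      ext i
      fin_cases i
      · exact congrArg Prod.fst h1
      · exact congrArg Prod.snd h1
    have hF : ∀ v, L (companionF (-a) *ᵥ v) = w 1 * L v := by
      intro v
      simp only [L, companionF, mulVec, dotProduct, Fin.sum_univ_two]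
      simp only [of_apply, cons_val', cons_val_zero, cons_val_one, cons_val_fin_one, zero_mul,
        zero_add, neg_mul, one_mul, neg_neg, map_neg, map_add, map_mul, ← ha]
      linear_combination (algebraMap (ZMod p) K (v 1)) * hmul
    have hFn : ∀ (n : ℕ) v, L (companionF (-a) ^ n *ᵥ v) = w 1 ^ n * L v := by
      intro n
      induction n with
      | zero => intro v; simp
      | succ n ih => intro v; rw [pow_succ', ← mulVec_mulVec, hF, ih, pow_succ', mul_assoc]
    refine orderOf_eq_prime ?_ ?_
    · apply mulVec_injective
      funext v
      apply hL
      rw [hFn, ← AddChar.map_nsmul_eq_pow, nsmul_one, CharP.cast_eq_zero,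
        AddChar.map_zero_eq_one, one_mul, one_mulVec]
    · intro h
      have h1 := congrFun (congrFun h 0) 0
      simp [companionF] at h1

end existence

section groupF

variable {p q : ℕ} [Fact p.Prime] [Fact q.Prime] {ξ : ZMod p}

theorem card_groupF (hF : orderOf (companionF ξ) = q) : Nat.card (GroupF ξ hF) = p ^ 2 * q := by
  have h1 : Nat.card (Multiplicative (Fin 2 → ZMod p)) = p ^ 2 := by
    rw [Nat.card_congr Multiplicative.toAdd, Nat.card_fun]
    simp
  have h2 : Nat.card (Multiplicative (ZMod q)) = q := Nat.card_zmod q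
  rw [SemidirectProduct.card, h1, h2]

theorem groupF_not_comm (hF : orderOf (companionF ξ) = q) :
    ¬ ∀ a b : GroupF ξ hF, a * b = b * a := by
  intro hc
  have hq := (Fact.out : q.Prime)
  have hF1 : companionF ξ = 1 := by
    apply mulVec_injective
    funext v
    have h1 := hc (SemidirectProduct.inr (.ofAdd 1)) (SemidirectProduct.inl (.ofAdd v))
    have h2 := congrArg SemidirectProduct.left h1
    simp only [SemidirectProduct.mul_left, SemidirectProduct.left_inr, one_mul,
      SemidirectProduct.right_inr, SemidirectProduct.left_inl, SemidirectProduct.right_inl,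
      map_one, mul_one] at h2
    have h3 : (companionF ξ ^ (1 : ZMod q).val) *ᵥ v = v := h2
    have : Fact (1 < q) := ⟨hq.one_lt⟩
    rw [ZMod.val_one, pow_one] at h3
    rw [h3, one_mulVec]
  rw [hF1, orderOf_one] at hF
  exact hq.ne_one hF.symm

end groupF

/-! ### The enumeration -/

namespace BundledSkewBrace

theorem HasMulGroup.of_iso {A B : BundledSkewBrace.{u}} {G : Type} [Group G] (f : A ≃+* B)
    (h : A.HasMulGroup G) : B.HasMulGroup G :=
  h.elim fun e => ⟨f.toMulEquiv.symm.trans e⟩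

theorem isTrivial_iff {B : BundledSkewBrace.{u}} (hB : Nat.card B ≠ 0) :
    SkewBrace.IsTrivial B ↔ B.cardKer = Nat.card B := by
  have : Finite B := Nat.finite_of_card_ne_zero hB
  rw [cardKer, Subgroup.card_eq_iff_eq_top, Subgroup.eq_top_iff']
  refine forall_congr' fun x => ?_
  rw [MonoidHom.mem_ker]
  constructor
  · intro h
    apply Multiplicative.toAdd.injective
    ext y
    rw [SkewBrace.lam_apply, h]
    exact neg_add_cancel_left x y
  · intro h y
    have h1 : (SkewBrace.lam B x).toAdd y = y := by rw [h]; rfl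
    rw [SkewBrace.lam_apply, neg_add_eq_iff_eq_add] at h1
    exact h1

end BundledSkewBrace

section enumeration

variable {p q : ℕ} [Fact p.Prime] [Fact q.Prime] {K : Type u} [Field K] [Algebra (ZMod p) K]
  {w : AddChar (ZMod q) K} {G : Type} [Group G]

theorem PairDatum.hasMulGroup_iff (hw : IsNormOneChar p w) (ε : G ≃* AffGroup w)
    (D : PairDatum w) : (D.brace hw).HasMulGroup G ↔ D.act ≠ 0 := by
  constructor
  · rintro ⟨e⟩ h0
    refine AffGroup.not_comm (hw.apply_ne_one one_ne_zero) fun a b => ?_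
    let e' : AffGroup w ≃* AffGroup (w.mulShift D.act) :=
      (ε.symm.trans e.symm).trans (D.mulEquiv hw)
    apply e'.injective
    rw [map_mul, map_mul]
    ext
    · simp [h0, add_comm]
    · simp [add_comm]
  · intro h0
    obtain ⟨e⟩ := nonempty_affGroup_mulEquiv hw (AffGroup.card_of_isNormOneChar hw _)
      (AffGroup.not_comm (w' := w.mulShift D.act)
        (by rw [AddChar.mulShift_apply, mul_one]; exact hw.apply_ne_one h0))
    exact ⟨(D.mulEquiv hw).trans (e.symm.trans ε.symm)⟩

theorem PairDatum.hasMulGroup_groupAb_iff (hw : IsNormOneChar p w) (D : PairDatum w) :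
    (D.brace hw).HasMulGroup (GroupAb p q) ↔ D.act = 0 := by
  constructor
  · rintro ⟨e⟩
    by_contra h0
    refine AffGroup.not_comm (w' := w.mulShift D.act)
      (by rw [AddChar.mulShift_apply, mul_one]; exact hw.apply_ne_one h0) fun a b => ?_
    apply ((D.mulEquiv hw).symm.trans e).injective
    rw [map_mul, map_mul, mul_comm]
  · intro h0
    obtain ⟨κ⟩ := hw.nonempty_addEquiv (A := Fin 2 → ZMod p) (by rw [Nat.card_fun]; simp)
    let e : AffGroup (w.mulShift D.act) ≃* GroupAb p q :=
      { toFun := fun g => .ofAdd (κ.symm g.trans, g.rot)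
        invFun := fun v => ⟨κ v.toAdd.1, v.toAdd.2⟩
        left_inv := fun g => by simp
        right_inv := fun v => by simp
        map_mul' := fun g h => by
          rw [AffGroup.trans_mul, AddChar.mulShift_apply,
            mul_eq_zero_of_left h0, AddChar.map_zero_eq_one,
            one_mul, map_add]
          rfl }
    exact ⟨(D.mulEquiv hw).trans e⟩

namespace BraceIndex

theorem isOfType (hw : IsNormOneChar p w) (ε : G ≃* AffGroup w) (i : BraceIndex p q) :
    (brace hw i).IsOfType G :=
  ⟨((datum hw i).isRealizedBy hw).addEquiv.trans (MulEquiv.toAdditive ε.symm)⟩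

theorem exists_iso_of_isOfType (hw : IsNormOneChar p w) (ε : G ≃* AffGroup w)
    {B : BundledSkewBrace.{u}} (hB : B.IsOfType G) : ∃ i, Nonempty (brace hw i ≃+* B) :=
  hB.elim fun e => exists_iso hw (e.trans (MulEquiv.toAdditive ε))

/-- Isomorphism classes of skew braces are counted by their indices. -/
theorem numIso_eq (hw : IsNormOneChar p w) (ε : G ≃* AffGroup w) (R : BundledSkewBrace.{u} → Prop)
    (hR : ∀ A B : BundledSkewBrace.{u}, A ≃+* B → R A → R B) :
    BundledSkewBrace.numIso.{u} (fun B => B.IsOfType G ∧ R B) =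
      (({j | R (brace hw (.inl j))}.ncard + ({j | R (brace hw (.inr (.inl j)))}.ncard +
        {n | R (brace hw (.inr (.inr n)))}.ncard) : ℕ) : ℕ∞) := by
  have himage : (fun B => Quotient.mk BundledSkewBrace.isoSetoid B) ''
      {B : BundledSkewBrace.{u} | B.IsOfType G ∧ R B} =
      (fun i => Quotient.mk BundledSkewBrace.isoSetoid (brace hw i)) ''
        {i : BraceIndex p q | R (brace hw i)} := by
    ext c
    constructor
    · rintro ⟨B, ⟨hB, hRB⟩, rfl⟩
      obtain ⟨i, ⟨f⟩⟩ := exists_iso_of_isOfType hw ε hB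
      exact ⟨i, hR _ _ f.symm hRB, Quotient.sound ⟨f⟩⟩
    · rintro ⟨i, hi, rfl⟩
      exact ⟨brace hw i, ⟨isOfType hw ε i, hi⟩, rfl⟩
  have hinj : Function.Injective fun i : BraceIndex p q =>
      Quotient.mk BundledSkewBrace.isoSetoid (brace hw i) := by
    intro i i' h
    obtain ⟨f⟩ := Quotient.exact h
    exact eq_of_iso hw f
  have hsum : ∀ {α β : Type} [Finite α] [Finite β] (S : Set (α ⊕ β)),
      S.ncard = {a | Sum.inl a ∈ S}.ncard + {b | Sum.inr b ∈ S}.ncard := by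
    intro α β _ _ S
    rw [← Nat.card_coe_set_eq, ← Nat.card_coe_set_eq, ← Nat.card_coe_set_eq, ← Nat.card_sum]
    exact Nat.card_congr (Equiv.subtypeSum (p := (· ∈ S)))
  rw [BundledSkewBrace.numIso, himage, hinj.encard_image,
    ← Set.Finite.cast_ncard_eq (Set.toFinite _), hsum, hsum]
  rfl

/-- The number of isomorphism classes with a given property, from the sets of indices with this
property in the three families. -/
theorem numIso_eq_of_forall_iff (hw : IsNormOneChar p w) (ε : G ≃* AffGroup w)
    {R : BundledSkewBrace.{u} → Prop} (hR : ∀ A B : BundledSkewBrace.{u}, A ≃+* B → R A → R B)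
    (S₁ S₂ : Set (ZMod q)) (S₃ : Set {n : ZMod p // n ≠ 0 ∧ n ≠ 1})
    (h₁ : ∀ j, R (brace hw (.inl j)) ↔ j ∈ S₁) (h₂ : ∀ j, R (brace hw (.inr (.inl j))) ↔ j ∈ S₂)
    (h₃ : ∀ n, R (brace hw (.inr (.inr n))) ↔ n ∈ S₃) {n : ℕ}
    (hn : S₁.ncard + (S₂.ncard + S₃.ncard) = n) :
    BundledSkewBrace.numIso.{u} (fun B => B.IsOfType G ∧ R B) = n := by
  rw [numIso_eq hw ε R hR, ← hn]
  simp only [h₁, h₂, h₃, Set.ofPred_mem_eq]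

theorem hasMulGroup_inl (hw : IsNormOneChar p w) (ε : G ≃* AffGroup w) (j : ZMod q) :
    (brace hw (.inl j)).HasMulGroup G ↔ j ≠ -1 :=
  (PairDatum.hasMulGroup_iff hw ε _).trans (not_congr eq_neg_iff_add_eq_zero.symm)

theorem hasMulGroup_inr_inl (hw : IsNormOneChar p w) (ε : G ≃* AffGroup w) (j : ZMod q) :
    (brace hw (.inr (.inl j))).HasMulGroup G ↔ j ≠ 0 :=
  PairDatum.hasMulGroup_iff hw ε _

theorem hasMulGroup_inr_inr (hw : IsNormOneChar p w) (ε : G ≃* AffGroup w)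
    (n : {n : ZMod p // n ≠ 0 ∧ n ≠ 1}) : (brace hw (.inr (.inr n))).HasMulGroup G :=
  (PairDatum.hasMulGroup_iff hw ε _).mpr (neg_ne_zero.mpr (inv_ne_zero hw.two_ne_zero))

theorem hasMulGroup_groupAb_inl (hw : IsNormOneChar p w) (j : ZMod q) :
    (brace hw (.inl j)).HasMulGroup (GroupAb p q) ↔ j = -1 :=
  (PairDatum.hasMulGroup_groupAb_iff hw _).trans eq_neg_iff_add_eq_zero.symm

theorem hasMulGroup_groupAb_inr_inl (hw : IsNormOneChar p w) (j : ZMod q) :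
    (brace hw (.inr (.inl j))).HasMulGroup (GroupAb p q) ↔ j = 0 :=
  PairDatum.hasMulGroup_groupAb_iff hw _

end BraceIndex

theorem ncard_compl_singleton {α : Type*} [Finite α] (a : α) :
    ({a}ᶜ : Set α).ncard = Nat.card α - 1 := by
  rw [Set.ncard_compl, Set.ncard_singleton]

theorem ncard_compl_pair {α : Type*} [Finite α] {a b : α} (h : a ≠ b) :
    ({a, b}ᶜ : Set α).ncard = Nat.card α - 2 := by
  rw [Set.ncard_compl, Set.ncard_pair h]

end enumeration

theorem mainTheorem3 (p q : ℕ) [Fact p.Prime] [Fact q.Prime] (hp : p ≠ 2) (hq : q ≠ 2)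
    (hpq : (p : ℤ) ≡ -1 [ZMOD (q : ℤ)]) :
    -- an irreducible polynomial `x² + ξ x + 1` whose companion matrix `F` has order `q` exists
    (∃ ξ : ZMod p, Irreducible (X ^ 2 + C ξ * X + 1 : (ZMod p)[X]) ∧
      orderOf (companionF ξ) = q) ∧
    ∀ (ξ : ZMod p) (_ : Irreducible (X ^ 2 + C ξ * X + 1 : (ZMod p)[X]))
      (hF : orderOf (companionF ξ) = q),
      -- `𝒢_F` is the unique non-abelian group of order `p² q`
      (Nat.card (GroupF ξ hF) = p ^ 2 * q ∧ (¬ ∀ a b : GroupF ξ hF, a * b = b * a) ∧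
        ∀ (G : Type u) [Group G], Nat.card G = p ^ 2 * q → (¬ ∀ a b : G, a * b = b * a) →
          Nonempty (G ≃* GroupF ξ hF)) ∧
      -- the total number of skew braces of `𝒢_F`-type, and the number of the non-trivial ones
      BundledSkewBrace.numIso.{u} (fun B => B.IsOfType (GroupF ξ hF)) = (p + 2 * q - 2 : ℕ) ∧
      BundledSkewBrace.numIso.{u} (fun B => B.IsOfType (GroupF ξ hF) ∧ ¬ SkewBrace.IsTrivial B) =
        (p + 2 * q - 3 : ℕ) ∧
      -- `|ker λ| = 1`
      BundledSkewBrace.numIso.{u} (fun B => B.IsOfType (GroupF ξ hF) ∧ B.cardKer = 1) = (p + q - 3 : ℕ) ∧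
      BundledSkewBrace.numIso.{u} (fun B => B.IsOfType (GroupF ξ hF) ∧ B.cardKer = 1 ∧
        B.HasMulGroup (GroupF ξ hF)) = (p + q - 3 : ℕ) ∧
      -- `|ker λ| = q`
      BundledSkewBrace.numIso.{u} (fun B => B.IsOfType (GroupF ξ hF) ∧ B.cardKer = q) = 1 ∧
      BundledSkewBrace.numIso.{u} (fun B => B.IsOfType (GroupF ξ hF) ∧ B.cardKer = q ∧
        B.HasMulGroup (GroupAb p q)) = 1 ∧
      -- `|ker λ| = p²`
      BundledSkewBrace.numIso.{u} (fun B => B.IsOfType (GroupF ξ hF) ∧ B.cardKer = p ^ 2) = (q - 1 : ℕ) ∧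
      BundledSkewBrace.numIso.{u} (fun B => B.IsOfType (GroupF ξ hF) ∧ B.cardKer = p ^ 2 ∧
        B.HasMulGroup (GroupAb p q)) = 1 ∧
      BundledSkewBrace.numIso.{u} (fun B => B.IsOfType (GroupF ξ hF) ∧ B.cardKer = p ^ 2 ∧
        B.HasMulGroup (GroupF ξ hF)) = (q - 2 : ℕ) ∧
      -- `|ker λ| = p² q`: the trivial skew brace
      BundledSkewBrace.numIso.{u} (fun B => B.IsOfType (GroupF ξ hF) ∧ B.cardKer = p ^ 2 * q) = 1 ∧
      (∀ B : BundledSkewBrace.{u}, B.IsOfType (GroupF ξ hF) →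
        (B.cardKer = p ^ 2 * q ↔ SkewBrace.IsTrivial B)) ∧
      -- no other values of `|ker λ|` occur
      (∀ B : BundledSkewBrace.{u}, B.IsOfType (GroupF ξ hF) →
        B.cardKer = 1 ∨ B.cardKer = q ∨ B.cardKer = p ^ 2 ∨ B.cardKer = p ^ 2 * q) := by
  have hpq' : (p : ZMod q) = -1 := by
    have h := (ZMod.intCast_eq_intCast_iff _ _ q).mpr hpq
    push_cast at h
    exact h
  obtain ⟨w, hw⟩ := exists_isNormOneChar (K := ULift.{u} (GaloisField p 2))
    ((Nat.card_ulift _).trans (GaloisField.card p 2 two_ne_zero)) hp hq hpq'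
  refine ⟨hw.exists_irreducible, fun ξ _ hF => ?_⟩
  obtain ⟨ε'⟩ := nonempty_affGroup_mulEquiv hw (card_groupF hF) (groupF_not_comm hF)
  have ε := ε'.symm
  have hp2 := (Fact.out : p.Prime).two_le
  have hq2 := (Fact.out : q.Prime).two_le
  have hlt := hw.lt
  have hq3 : 3 ≤ q := by omega
  -- the four possible values of `|ker λ|` are distinct
  have n1 : p ^ 2 ≠ 1 := by nlinarith
  have n2 : p ^ 2 * q ≠ 1 := by nlinarith
  have n3 : q ≠ 1 := by omega
  have n4 : p ^ 2 ≠ q := by nlinarith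
  have n5 : p ^ 2 * q ≠ q := by nlinarith
  have n6 : p ^ 2 * q ≠ p ^ 2 := by nlinarith
  have hcardB : ∀ B : BundledSkewBrace.{u}, B.IsOfType (GroupF ξ hF) → Nat.card B = p ^ 2 * q :=
    fun B ⟨e⟩ => (Nat.card_congr (e.toEquiv.trans Additive.toMul)).trans (card_groupF hF)
  have htriv : ∀ B : BundledSkewBrace.{u}, B.IsOfType (GroupF ξ hF) →
      (B.cardKer = p ^ 2 * q ↔ SkewBrace.IsTrivial B) := by
    intro B hB
    have h0 : Nat.card B ≠ 0 := by rw [hcardB B hB]; positivity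
    rw [BundledSkewBrace.isTrivial_iff h0, hcardB B hB]
  have hker : ∀ i : BraceIndex p q, (BraceIndex.brace hw i).cardKer = 1 ∨
      (BraceIndex.brace hw i).cardKer = q ∨ (BraceIndex.brace hw i).cardKer = p ^ 2 ∨
      (BraceIndex.brace hw i).cardKer = p ^ 2 * q := by
    rintro (j | j | n)
    · rw [BraceIndex.cardKer_inl]; split_ifs <;> simp
    · rw [BraceIndex.cardKer_inr_inl]; split_ifs <;> simp
    · rw [BraceIndex.cardKer_inr_inr]; simp
  have c1 : ({0}ᶜ : Set (ZMod q)).ncard = q - 1 := by rw [ncard_compl_singleton, Nat.card_zmod]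
  have c2 : ({0, -1}ᶜ : Set (ZMod q)).ncard = q - 2 := by
    rw [ncard_compl_pair (neg_ne_zero.mpr one_ne_zero).symm, Nat.card_zmod]
  have c3 : (Set.univ : Set (ZMod q)).ncard = q := by rw [Set.ncard_univ, Nat.card_zmod]
  have c4 : (Set.univ : Set {n : ZMod p // n ≠ 0 ∧ n ≠ 1}).ncard = p - 2 := by
    have h := ncard_compl_pair (zero_ne_one (α := ZMod p))
    rw [Nat.card_zmod, ← Nat.card_coe_set_eq] at h
    rw [Set.ncard_univ, ← h]
    exact Nat.card_congr (Equiv.subtypeEquivRight fun n => by simp)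
  have hR : ∀ v : ℕ, ∀ A B : BundledSkewBrace.{u}, A ≃+* B → A.cardKer = v → B.cardKer = v :=
    fun v A B f h => (BundledSkewBrace.cardKer_eq_of_iso f).symm.trans h
  have hR' : ∀ (v : ℕ) (H : Type) [Group H], ∀ A B : BundledSkewBrace.{u}, A ≃+* B →
      A.cardKer = v ∧ A.HasMulGroup H → B.cardKer = v ∧ B.HasMulGroup H :=
    fun v H _ A B f h => ⟨hR v A B f h.1, h.2.of_iso f⟩
  have hneg : (0 : ZMod q) ≠ -1 := (neg_ne_zero.mpr one_ne_zero).symm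
  -- in each count, the sets are those of the indices in the three families that are counted
  refine ⟨⟨card_groupF hF, groupF_not_comm hF, fun G _ hG hnc => ?_⟩,
    ?_, ?_, ?_, ?_, ?_, ?_, ?_, ?_, ?_, ?_, htriv, fun B hB => ?_⟩
  · obtain ⟨e⟩ := nonempty_affGroup_mulEquiv hw hG hnc
    exact ⟨e.symm.trans ε.symm⟩
  · have h := BraceIndex.numIso_eq_of_forall_iff hw ε (R := fun _ => True) (fun _ _ _ h => h)
      Set.univ Set.univ Set.univ (by simp) (by simp) (by simp) (n := p + 2 * q - 2)
      (by rw [c3, c4]; omega)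
    simpa only [and_true] using h
  · have hRR : (fun B : BundledSkewBrace.{u} =>
        B.IsOfType (GroupF ξ hF) ∧ ¬ SkewBrace.IsTrivial B) =
        fun B => B.IsOfType (GroupF ξ hF) ∧ B.cardKer ≠ p ^ 2 * q := by
      funext B
      exact propext (and_congr_right fun hB => not_congr (htriv B hB).symm)
    rw [hRR]
    refine BraceIndex.numIso_eq_of_forall_iff hw ε (fun A B f h h' => h (hR _ B A f.symm h'))
      {0}ᶜ Set.univ Set.univ (fun j => ?_) (fun j => ?_) (fun n => ?_) (by rw [c1, c3, c4]; omega)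
    · rw [BraceIndex.cardKer_inl]; split_ifs with hj <;> simp [hj, n6.symm]
    · rw [BraceIndex.cardKer_inr_inl]; split_ifs <;> simp [n5.symm, n2.symm]
    · rw [BraceIndex.cardKer_inr_inr]; simp [n2.symm]
  · refine BraceIndex.numIso_eq_of_forall_iff hw ε (hR 1) ∅ {0}ᶜ Set.univ
      (fun j => ?_) (fun j => ?_) (fun n => ?_) (by rw [c1, c4, Set.ncard_empty]; omega)
    · rw [BraceIndex.cardKer_inl]; split_ifs <;> simp only [n1, n2, Set.mem_empty_iff_false]
    · rw [BraceIndex.cardKer_inr_inl]; split_ifs with hj <;> simp [hj, n3]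
    · rw [BraceIndex.cardKer_inr_inr]; simp
  · refine BraceIndex.numIso_eq_of_forall_iff hw ε (hR' 1 _) ∅ {0}ᶜ Set.univ
      (fun j => ?_) (fun j => ?_) (fun n => ?_) (by rw [c1, c4, Set.ncard_empty]; omega)
    · rw [BraceIndex.cardKer_inl]
      split_ifs <;> simp only [n1, n2, Set.mem_empty_iff_false, false_and]
    · rw [BraceIndex.cardKer_inr_inl, BraceIndex.hasMulGroup_inr_inl hw ε]
      split_ifs with hj <;> simp [hj]
    · simp [BraceIndex.cardKer_inr_inr, BraceIndex.hasMulGroup_inr_inr hw ε]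
  · rw [← Nat.cast_one]
    refine BraceIndex.numIso_eq_of_forall_iff hw ε (hR q) ∅ {0} ∅
      (fun j => ?_) (fun j => ?_) (fun n => ?_)
      (by rw [Set.ncard_empty, Set.ncard_empty, Set.ncard_singleton])
    · rw [BraceIndex.cardKer_inl]; split_ifs <;> simp only [n4, n5, Set.mem_empty_iff_false]
    · rw [BraceIndex.cardKer_inr_inl]; split_ifs with hj <;> simp [hj, n3.symm]
    · rw [BraceIndex.cardKer_inr_inr]; simp [n3.symm]
  · rw [← Nat.cast_one]
    refine BraceIndex.numIso_eq_of_forall_iff hw ε (hR' q _) ∅ {0} ∅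
      (fun j => ?_) (fun j => ?_) (fun n => ?_)
      (by rw [Set.ncard_empty, Set.ncard_empty, Set.ncard_singleton])
    · rw [BraceIndex.cardKer_inl]
      split_ifs <;> simp only [n4, n5, Set.mem_empty_iff_false, false_and]
    · rw [BraceIndex.cardKer_inr_inl, BraceIndex.hasMulGroup_groupAb_inr_inl]
      split_ifs with hj <;> simp [hj]
    · rw [BraceIndex.cardKer_inr_inr]; simp [n3.symm]
  · refine BraceIndex.numIso_eq_of_forall_iff hw ε (hR (p ^ 2)) {0}ᶜ ∅ ∅
      (fun j => ?_) (fun j => ?_) (fun n => ?_)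
      (by rw [c1, Set.ncard_empty, Set.ncard_empty, add_zero, add_zero])
    · rw [BraceIndex.cardKer_inl]; split_ifs with hj <;> simp only [hj, n6] <;> simp [hj]
    · rw [BraceIndex.cardKer_inr_inl]
      split_ifs <;> simp only [n4.symm, n1.symm, Set.mem_empty_iff_false]
    · rw [BraceIndex.cardKer_inr_inr]; simp only [n1.symm, Set.mem_empty_iff_false]
  · rw [← Nat.cast_one]
    refine BraceIndex.numIso_eq_of_forall_iff hw ε (hR' (p ^ 2) _) {-1} ∅ ∅
      (fun j => ?_) (fun j => ?_) (fun n => ?_)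
      (by rw [Set.ncard_singleton, Set.ncard_empty, Set.ncard_empty])
    · rw [BraceIndex.cardKer_inl, BraceIndex.hasMulGroup_groupAb_inl]
      split_ifs with hj <;> simp only [hj, n6, false_and, true_and] <;> simp [hneg]
    · rw [BraceIndex.cardKer_inr_inl]
      split_ifs <;> simp only [n4.symm, n1.symm, Set.mem_empty_iff_false, false_and]
    · rw [BraceIndex.cardKer_inr_inr]; simp only [n1.symm, Set.mem_empty_iff_false, false_and]
  · refine BraceIndex.numIso_eq_of_forall_iff hw ε (hR' (p ^ 2) _) {0, -1}ᶜ ∅ ∅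
      (fun j => ?_) (fun j => ?_) (fun n => ?_)
      (by rw [c2, Set.ncard_empty, Set.ncard_empty, add_zero, add_zero])
    · rw [BraceIndex.cardKer_inl, BraceIndex.hasMulGroup_inl hw ε]
      split_ifs with hj <;> simp only [hj, n6, false_and, true_and] <;> simp [hj]
    · rw [BraceIndex.cardKer_inr_inl]
      split_ifs <;> simp only [n4.symm, n1.symm, Set.mem_empty_iff_false, false_and]
    · rw [BraceIndex.cardKer_inr_inr]; simp only [n1.symm, Set.mem_empty_iff_false, false_and]
  · rw [← Nat.cast_one]
    refine BraceIndex.numIso_eq_of_forall_iff hw ε (hR (p ^ 2 * q)) {0} ∅ ∅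
      (fun j => ?_) (fun j => ?_) (fun n => ?_)
      (by rw [Set.ncard_singleton, Set.ncard_empty, Set.ncard_empty])
    · rw [BraceIndex.cardKer_inl]; split_ifs with hj <;> simp only [hj, n6.symm] <;> simp [hj]
    · rw [BraceIndex.cardKer_inr_inl]
      split_ifs <;> simp only [n5.symm, n2.symm, Set.mem_empty_iff_false]
    · rw [BraceIndex.cardKer_inr_inr]; simp only [n2.symm, Set.mem_empty_iff_false]
  · obtain ⟨i, ⟨f⟩⟩ := BraceIndex.exists_iso_of_isOfType hw ε hB
    rw [← BundledSkewBrace.cardKer_eq_of_iso f]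
    exact hker i
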